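/- Let $H\in M(p,\mathbb{R})$ be a matrix all of whose (complex) eigenvalues have real part in $(0,1)$, put $D=H-\tfrac12 I$, and write $c^{M}=\exp(M\log c)$ for $c>0$. For $A\in M(p,\mathbb{C})$ and $t\in\mathbb{R}$ let $$\widetilde g_t(x)=\frac{e^{\mathbf{i}tx}-1}{\mathbf{i}x}\bigl\{x_+^{-D}A+x_-^{-D}\overline{A}\bigr\},\quad x\neq0,\qquad g_t=\mathcal F^{-1}(\widetilde g_t)\in L^2(\mathbb{R},M(p,\mathbb{R})),$$ where $\mathcal F f(x)=\int_{\mathbb{R}}e^{\mathbf{i}sx}f(s)\,ds$ is extended entrywise to $L^2$. Let $\mu$ be a measure on $\mathbb{R}^p$ (respectively $\mathbb{C}^p$) with $\int\|\mathbf z\|^2\mu(d\mathbf z)<\infty$ and $\mu(\{\mathbf 0\})=0$ (the Lévy measure), let $N$ be a Poisson random measure on $\mathbb{R}\times\mathbb{R}^p$ (respectively $\mathbb{R}\times\mathbb{C}^p$) with intensity $ds\,\mu(d\mathbf z)$, and let $\widetilde N=N-ds\,\mu(d\mathbf z)$; integrals with respect to $\widetilde N$ are $L^2(\mathbb{P})$-limits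 of integrals of elementary functions. An $\mathbb{R}^p$-valued process is called proper if, for every $t\neq0$, its law at time $t$ is not concentrated on a proper linear subspace of $\mathbb{R}^p$. A moving average operator fractional Lévy motion (maofLm) with Hurst exponent $H$ and Lévy measure $\mu$ on $\mathbb{R}^p$ is a proper process $X_H$ with the finite-dimensional distributions of $\bigl\{\int_{\mathbb{R}\times\mathbb{R}^p}g_t(s)\mathbf z\,\widetilde N(ds,d\mathbf z)\bigr\}_{t\in\mathbb{R}}$ for some $A$. A real harmonizable operator fractional Lévy motion (rhofLm) with Hurst exponent $H$ and Lévy measure $\mu$ on $\mathbb{C}^p$ is a proper process $\widetilde X_H$ with the finite-dimensional distributions of $\bigl\{\int_{\mathbb{R}\times\mathbb{C}^p}2\Re(\widetilde g_t(x)\mathbf z)\,\widetilde N(dx,d\mathbf z)\bigr\}_{t\in\mathbb{R}}$ for some $A$. An operator fractional Brownian motion (ofBm) with Hurst exponent $H$ is a proper Gaussian process $B_H=\{B_H(t)\}_{t\in\mathbb{R}}$ with stationary increments such that $\{B_H(ct)\}_{t\in\mathbb{R}}$ and $\{c^HB_H(t)\}_{t\in\mathbb{R}}$ have the same finite-dimensional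 distributions for every $c>0$. (i) Let $X_H$ be a maofLm with Hurst exponent $H$ whose Lévy measure satisfies $\int_{\mathbb{R}^p}\mathbf z\mathbf z^*\mu(d\mathbf z)=I$. Then there is an ofBm $B_H$ with Hurst exponent $H$ such that, as $c\to\infty$, $$\{c^{-H}X_H(ct)\}_{t\in\mathbb{R}}\to\{B_H(t)\}_{t\in\mathbb{R}}$$ in the sense of convergence of finite-dimensional distributions. (ii) Let $\widetilde X_H$ be a rhofLm with Hurst exponent $H$ whose Lévy measure satisfies $4\int_{\mathbb{C}^p}(\Re\mathbf z)(\Re\mathbf z)^*\mu(d\mathbf z)=I=4\int_{\mathbb{C}^p}(\Im\mathbf z)(\Im\mathbf z)^*\mu(d\mathbf z)$. Then there is an ofBm $B_H$ with Hurst exponent $H$ such that, for every fixed $s\in\mathbb{R}$, as $\varepsilon\to0^+$, $$\{\varepsilon^{-H}(\widetilde X_H(s+\varepsilon t)-\widetilde X_H(s))\}_{t\in\mathbb{R}}\to\{B_H(t)\}_{t\in\mathbb{R}}$$ in the sense of convergence of finite-dimensional distributions. -/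

import Mathlib

open MeasureTheory ProbabilityTheory Filter Topology
open scoped ENNReal NNReal FourierTransform

universe u v

noncomputable section

namespace OfLm

/-! ### Matrix powers and conditions on the Hurst matrix -/

/-- The matrix power `c ^ M = exp (log c • M)`, for `c > 0`. -/
def matPow {p : ℕ} (c : ℝ) (M : Matrix (Fin p) (Fin p) ℝ) : Matrix (Fin p) (Fin p) ℝ :=
  NormedSpace.exp (Real.log c • M)

/-- A real matrix regarded as a complex matrix. -/
def toComplex {p : ℕ} (M : Matrix (Fin p) (Fin p) ℝ) : Matrix (Fin p) (Fin p) ℂ :=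
  M.map (fun r : ℝ => (r : ℂ))

/-- The real parts of all the (complex) eigenvalues of `H` lie in the set `S`. -/
def ReEigIn {p : ℕ} (H : Matrix (Fin p) (Fin p) ℝ) (S : Set ℝ) : Prop :=
  ∀ z ∈ spectrum ℂ (toComplex H), z.re ∈ S

/-! ### Finite-dimensional distributions -/

section Processes

variable {Ω Ω' : Type*} [MeasurableSpace Ω] [MeasurableSpace Ω'] {p : ℕ}

/-- Equality of the finite-dimensional distributions of `X` (under `P`) and `Y` (under `P'`). -/
def FddEq (P : Measure Ω) (X : ℝ → Ω → EuclideanSpace ℝ (Fin p))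
    (P' : Measure Ω') (Y : ℝ → Ω' → EuclideanSpace ℝ (Fin p)) : Prop :=
  ∀ I : Finset ℝ, IdentDistrib (fun ω => I.restrict (fun t => X t ω))
    (fun ω => I.restrict (fun t => Y t ω)) P P'

/-- Convergence of finite-dimensional distributions, along the filter `l`, of the processes
`X c` (under `P`) to the process `B` (under `P'`). -/
def FddTendsto (P : Measure Ω) [IsProbabilityMeasure P]
    (X : ℝ → ℝ → Ω → EuclideanSpace ℝ (Fin p)) (l : Filter ℝ)
    (P' : Measure Ω') [IsProbabilityMeasure P'] (B : ℝ → Ω' → EuclideanSpace ℝ (Fin p)) : Prop :=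
  ∀ I : Finset ℝ, TendstoInDistribution (fun c ω => I.restrict (fun t => X c t ω)) l
    (fun ω => I.restrict (fun t => B t ω)) (fun _ => P) P'

/-- For each `t ≠ 0`, the law of `X t` is not concentrated on any proper subspace. -/
def IsProper (P : Measure Ω) (X : ℝ → Ω → EuclideanSpace ℝ (Fin p)) : Prop :=
  ∀ t : ℝ, t ≠ 0 → ∀ V : Submodule ℝ (EuclideanSpace ℝ (Fin p)), V ≠ ⊤ →
    ¬ ∀ᵐ ω ∂P, X t ω ∈ V

/-- Operator fractional Brownian motion with Hurst exponent `H`: a proper Gaussian process which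
is operator self-similar with exponent `H` and has (strictly) stationary increments. -/
structure IsOfBm (P : Measure Ω) (B : ℝ → Ω → EuclideanSpace ℝ (Fin p))
    (H : Matrix (Fin p) (Fin p) ℝ) : Prop where
  hurst : ReEigIn H (Set.Ioc 0 1)
  gaussian : IsGaussianProcess B P
  proper : IsProper P B
  selfSimilar : ∀ c : ℝ, 0 < c →
    FddEq P (fun t => B (c * t)) P (fun t ω => Matrix.toEuclideanLin (matPow c H) (B t ω))
  stationaryIncrements : ∀ h : ℝ,
    FddEq P (fun t ω => B (t + h) ω - B h ω) P (fun t ω => B t ω - B 0 ω)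

end Processes

/-! ### Poisson random measures and integrals with respect to their compensation -/

/-- `N` is a Poisson random measure on `S` with intensity measure `ν`. -/
structure IsPoissonRandomMeasure {Ω S : Type*} [MeasurableSpace Ω] [MeasurableSpace S]
    (P : Measure Ω) (N : Ω → Measure S) (ν : Measure S) : Prop where
  measurable : ∀ B : Set S, MeasurableSet B → Measurable (fun ω => N ω B)
  law : ∀ B : Set S, MeasurableSet B → ν B ≠ ∞ →
    P.map (fun ω => N ω B) =
      (poissonMeasure (ν B).toNNReal).map (fun k : ℕ => (k : ℝ≥0∞))
  law_top : ∀ B : Set S, MeasurableSet B → ν B = ∞ → ∀ᵐ ω ∂P, N ω B = ∞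
  indep : ∀ (n : ℕ) (B : Fin n → Set S), (∀ i, MeasurableSet (B i)) →
    Pairwise (fun i j => Disjoint (B i) (B j)) → iIndepFun (fun i ω => N ω (B i)) P

/-- The compensated random measure `N(B) - ν(B)`, on sets `B` with `ν B < ∞`. -/
def compensated {Ω S : Type*} [MeasurableSpace S] (N : Ω → Measure S) (ν : Measure S)
    (B : Set S) (ω : Ω) : ℝ :=
  (N ω B).toReal - (ν B).toReal

/-- Elementary functions `∑ i, φ_i 1_{B_{1,i} × B_{2,i}}` on `ℝ × Z`, where the measurable
rectangles have finite `ν`-measure. -/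
structure Elementary {Z : Type*} [MeasurableSpace Z] (ν : Measure (ℝ × Z)) (p : ℕ) where
  size : ℕ
  coef : Fin size → EuclideanSpace ℝ (Fin p)
  left : Fin size → Set ℝ
  right : Fin size → Set Z
  measurableSet_left : ∀ i, MeasurableSet (left i)
  measurableSet_right : ∀ i, MeasurableSet (right i)
  finite : ∀ i, ν (left i ×ˢ right i) ≠ ∞

/-- The function that an elementary function stands for. -/
def Elementary.toFun {Z : Type*} [MeasurableSpace Z] {ν : Measure (ℝ × Z)} {p : ℕ}
    (e : Elementary ν p) (x : ℝ × Z) : EuclideanSpace ℝ (Fin p) :=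
  ∑ i, (e.left i ×ˢ e.right i).indicator (fun _ => e.coef i) x

/-- The integral of an elementary function against the compensated random measure. -/
def Elementary.integral {Ω Z : Type*} [MeasurableSpace Z] {ν : Measure (ℝ × Z)} {p : ℕ}
    (e : Elementary ν p) (N : Ω → Measure (ℝ × Z)) (ω : Ω) : EuclideanSpace ℝ (Fin p) :=
  ∑ i, compensated N ν (e.left i ×ˢ e.right i) ω • e.coef i

/-- The random vector `Y` is (a version of) the stochastic integral of the function
`φ ∈ 𝓛²(ν)` with respect to the compensated Poisson random measure `N - ν`: it is the
`L²(P)`-limit of the integrals of elementary functions that converge to `φ` in `𝓛²(ν)`. -/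
def IsStochIntegral {Ω Z : Type*} [MeasurableSpace Ω] [MeasurableSpace Z] {p : ℕ}
    (P : Measure Ω) (N : Ω → Measure (ℝ × Z)) (ν : Measure (ℝ × Z))
    (φ : ℝ × Z → EuclideanSpace ℝ (Fin p)) (Y : Ω → EuclideanSpace ℝ (Fin p)) : Prop :=
  MemLp φ 2 ν ∧ MemLp Y 2 P ∧
    ∃ e : ℕ → Elementary ν p,
      Tendsto (fun n => eLpNorm (fun x => (e n).toFun x - φ x) 2 ν) atTop (𝓝 0) ∧
      Tendsto (fun n => eLpNorm (fun ω => (e n).integral N ω - Y ω) 2 P) atTop (𝓝 0)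

/-- A Lévy measure with finite second moment: `∫ ‖z‖² dμ < ∞` and `μ {0} = 0`. -/
structure IsLevyMeasure₂ {E : Type*} [NormedAddCommGroup E] [MeasurableSpace E]
    (μ : Measure E) : Prop where
  secondMoment : ∫⁻ z, ‖z‖ₑ ^ 2 ∂μ < ∞
  zero : μ {0} = 0

/-! ### The kernels -/

/-- The Fourier domain kernel
`g̃_t(x) = (e^{itx} - 1) / (ix) * (x₊^{-D} A + x₋^{-D} conj A)` with `D = H - (1/2) I`. -/
def harmKernel {p : ℕ} (H : Matrix (Fin p) (Fin p) ℝ) (A : Matrix (Fin p) (Fin p) ℂ)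
    (t x : ℝ) : Matrix (Fin p) (Fin p) ℂ :=
  let D : Matrix (Fin p) (Fin p) ℝ := H - (1 / 2 : ℝ) • (1 : Matrix (Fin p) (Fin p) ℝ)
  ((Complex.exp (Complex.I * t * x) - 1) / (Complex.I * x)) •
    (if 0 < x then toComplex (matPow x (-D)) * A
      else if x < 0 then toComplex (matPow (-x) (-D)) * A.map (starRingEnd ℂ)
      else 0)

/-- `F ∈ L²(ℝ)` is the Fourier transform of `f ∈ L²(ℝ)` in the normalization
`F(x) = ∫ e^{isx} f(s) ds` (extended to `L²`). In Mathlib's normalization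
`(𝓕 f)(ξ) = ∫ e^{-2πisξ} f(s) ds` this means that `(𝓕 f)(ξ) = F(-2πξ)`. -/
def IsL2Fourier (f F : ℝ → ℂ) : Prop :=
  ∃ (hf : MemLp f 2 volume) (hF : MemLp (fun ξ : ℝ => F (-(2 * Real.pi * ξ))) 2 volume),
    𝓕 (hf.toLp f) = hF.toLp (fun ξ : ℝ => F (-(2 * Real.pi * ξ)))

/-- The time domain kernel: `g_t ∈ L²(ℝ, M(p, ℝ))` is the entrywise inverse Fourier transform of
the Fourier domain kernel `g̃_t`, for every `t`. -/
def IsTimeKernel {p : ℕ} (H : Matrix (Fin p) (Fin p) ℝ) (A : Matrix (Fin p) (Fin p) ℂ)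
    (g : ℝ → ℝ → Matrix (Fin p) (Fin p) ℝ) : Prop :=
  ∀ (t : ℝ) (i j : Fin p),
    IsL2Fourier (fun s => ((g t s i j : ℝ) : ℂ)) (fun x => harmKernel H A t x i j)

/-! ### Operator fractional Lévy motions -/

/-- `X` is a moving average operator fractional Lévy motion (without Gaussian component) with
Hurst matrix `H`, parameter `A` and Lévy measure `μ`: it is proper and has the finite-dimensional
distributions of `t ↦ ∫ g_t(s) z (N(ds, dz) - ds μ(dz))`, where `N` is a Poisson random measure on
`ℝ × ℝ^p` with intensity `ds ⊗ μ`. -/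
structure IsMaofLm {Ω : Type u} [MeasurableSpace Ω] {p : ℕ} (P : Measure Ω)
    (X : ℝ → Ω → EuclideanSpace ℝ (Fin p)) (H : Matrix (Fin p) (Fin p) ℝ)
    (A : Matrix (Fin p) (Fin p) ℂ) (μ : Measure (EuclideanSpace ℝ (Fin p))) : Prop where
  hurst : ReEigIn H (Set.Ioo 0 1)
  levy : IsLevyMeasure₂ μ
  proper : IsProper P X
  representation : ∃ (Ω' : Type v) (_ : MeasurableSpace Ω') (P' : Measure Ω')
    (N : Ω' → Measure (ℝ × EuclideanSpace ℝ (Fin p)))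
    (g : ℝ → ℝ → Matrix (Fin p) (Fin p) ℝ) (Y : ℝ → Ω' → EuclideanSpace ℝ (Fin p)),
    IsProbabilityMeasure P' ∧
    IsPoissonRandomMeasure P' N ((volume : Measure ℝ).prod μ) ∧
    IsTimeKernel H A g ∧
    (∀ t, IsStochIntegral P' N ((volume : Measure ℝ).prod μ)
      (fun x => Matrix.toEuclideanLin (g t x.1) x.2) (Y t)) ∧
    FddEq P X P' Y

/-- `X` is a real harmonizable operator fractional Lévy motion (without Gaussian component) with
Hurst matrix `H`, parameter `A` and Lévy measure `μ`: it is proper and has the finite-dimensional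
distributions of `t ↦ ∫ 2 Re (g̃_t(x) z) (N(dx, dz) - dx μ(dz))`, where `N` is a Poisson random
measure on `ℝ × ℂ^p` with intensity `dx ⊗ μ`. -/
structure IsRhofLm {Ω : Type u} [MeasurableSpace Ω] {p : ℕ} (P : Measure Ω)
    (X : ℝ → Ω → EuclideanSpace ℝ (Fin p)) (H : Matrix (Fin p) (Fin p) ℝ)
    (A : Matrix (Fin p) (Fin p) ℂ) (μ : Measure (EuclideanSpace ℂ (Fin p))) : Prop where
  hurst : ReEigIn H (Set.Ioo 0 1)
  levy : IsLevyMeasure₂ μ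
  proper : IsProper P X
  representation : ∃ (Ω' : Type v) (_ : MeasurableSpace Ω') (P' : Measure Ω')
    (N : Ω' → Measure (ℝ × EuclideanSpace ℂ (Fin p)))
    (Y : ℝ → Ω' → EuclideanSpace ℝ (Fin p)),
    IsProbabilityMeasure P' ∧
    IsPoissonRandomMeasure P' N ((volume : Measure ℝ).prod μ) ∧
    (∀ t, IsStochIntegral P' N ((volume : Measure ℝ).prod μ)
      (fun x => WithLp.toLp 2
        (fun i => 2 * (Matrix.toEuclideanLin (harmKernel H A t x.1) x.2 i).re)) (Y t)) ∧
    FddEq P X P' Y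

/-- `∫ z z^* μ(dz) = I`. -/
def HasIdentitySecondMoment {p : ℕ} (μ : Measure (EuclideanSpace ℝ (Fin p))) : Prop :=
  ∀ i j, ∫ z, z i * z j ∂μ = (1 : Matrix (Fin p) (Fin p) ℝ) i j

/-- `4 ∫ (Re z) (Re z)^* μ(dz) = I = 4 ∫ (Im z) (Im z)^* μ(dz)`. -/
def HasComplexIdentitySecondMoment {p : ℕ} (μ : Measure (EuclideanSpace ℂ (Fin p))) : Prop :=
  (∀ i j, 4 * ∫ z, (z i).re * (z j).re ∂μ = (1 : Matrix (Fin p) (Fin p) ℝ) i j) ∧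
  (∀ i j, 4 * ∫ z, (z i).im * (z j).im ∂μ = (1 : Matrix (Fin p) (Fin p) ℝ) i j)

end OfLm

end

noncomputable section

namespace OfLm

/-!
A compensated Poisson integral `∫ φ dÑ` has characteristic functional `exp ∫ (e^{iu} - 1 - iu) dν`,
with `u` the tested kernel. Both classes of kernels are self-similar, so the rescaled process has
as kernel a unitary dilation in the `ℝ` variable of the original one, which amounts to multiplying
the intensity by `r → ∞` and the kernel by `r^{-1/2}`. In the limit only the quadratic term of
`e^{iu} - 1 - iu` survives and gives the Gaussian functional `exp (-½ ∫ u² dν)`. The process `B_H`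
is the Gaussian one with this functional. Self-similarity and stationarity of increments only
concern its covariance, that is, `∫ u² dν`. Properness means that no tested kernel at `t ≠ 0`
vanishes almost everywhere, a property which the Poisson and the Gaussian functional share.

For (i), increments correspond to translations of the time domain kernel. For (ii), they multiply
`g̃_t(x)` by the phase `e^{ihx}`. Reflecting `x ↦ -x` replaces the kernel by its conjugate, and
since `Re z` and `Im z` have the same second moments, the average of `(Re (w · z))²` over `w` and
its conjugate is a sesquilinear expression in `w`, which the phase leaves unchanged.
-/

section LinComb

variable {T S J E : Type*} [Fintype J] [NormedAddCommGroup E] [InnerProductSpace ℝ E]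

/-- The linear functional `∑ⱼ ⟪θⱼ, f (tⱼ)⟫` of a family of vector-valued functions. It is applied
both to processes, whose finite-dimensional distributions it probes, and to the kernels of the
stochastic integrals that represent them. -/
def linComb (f : T → S → E) (t : J → T) (θ : J → E) (x : S) : ℝ :=
  ∑ j, inner ℝ (θ j) (f (t j) x)

theorem linComb_unit (f : T → S → E) (t : T) (θ : E) :
    linComb f (fun _ : Unit => t) (fun _ => θ) = fun x => inner ℝ θ (f t x) := by
  funext x
  simp [linComb]

theorem linComb_linearMap [FiniteDimensional ℝ E] (L : E →ₗ[ℝ] E) (f : T → S → E) (t : J → T)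
    (θ : J → E) :
    linComb (fun t x => L (f t x)) t θ = linComb f t (fun j => L.adjoint (θ j)) := by
  funext x
  simp only [linComb, LinearMap.adjoint_inner_left]

theorem linComb_sub {T' : Type*} (f : T' → S → E) (a b : T → T') (t : J → T) (θ : J → E) :
    linComb (fun t x => f (a t) x - f (b t) x) t θ
      = linComb f (Sum.elim (a ∘ t) (b ∘ t)) (Sum.elim θ (-θ)) := by
  funext x
  simp [linComb, inner_sub_right, ← sub_eq_add_neg]

theorem linComb_smul (f : T → S → E) (t : J → T) (θ : J → E) (r : ℝ) :
    linComb f t (r • θ) = r • linComb f t θ := by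
  funext x
  simp [linComb, inner_smul_left, Finset.mul_sum]

theorem linComb_sub_linComb (f g : T → S → E) (t : J → T) (θ : J → E) :
    linComb f t θ - linComb g t θ = linComb (fun t x => f t x - g t x) t θ := by
  funext x
  simp [linComb, inner_sub_right, Finset.sum_sub_distrib]

variable [MeasurableSpace S] {ν : Measure S} {f : T → S → E}

theorem memLp_linComb {q : ℝ≥0∞} (hf : ∀ t, MemLp (f t) q ν) (t : J → T) (θ : J → E) :
    MemLp (linComb f t θ) q ν :=
  memLp_finsetSum _ fun j _ => (hf (t j)).const_inner (θ j)

theorem tendsto_eLpNorm_linComb_sub {ι : Type*} {l : Filter ι} {q : ℝ≥0∞} (hq : 1 ≤ q)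
    {F : ι → T → S → E} (hF : ∀ n t, AEStronglyMeasurable (F n t) ν)
    (hf : ∀ t, AEStronglyMeasurable (f t) ν)
    (h : ∀ t, Tendsto (fun n => eLpNorm (fun x => F n t x - f t x) q ν) l (𝓝 0))
    (t : J → T) (θ : J → E) :
    Tendsto (fun n => eLpNorm (linComb (F n) t θ - linComb f t θ) q ν) l (𝓝 0) := by
  have hbound : ∀ n, eLpNorm (linComb (F n) t θ - linComb f t θ) q ν
      ≤ ∑ j, ENNReal.ofReal ‖θ j‖ * eLpNorm (fun x => F n (t j) x - f (t j) x) q ν := by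
    intro n
    have hsum : linComb (F n) t θ - linComb f t θ
        = ∑ j, fun x => inner ℝ (θ j) (F n (t j) x - f (t j) x) := by
      rw [linComb_sub_linComb]
      funext x
      simp [linComb]
    rw [hsum]
    refine (eLpNorm_sum_le (fun j _ => ((hF n (t j)).sub (hf (t j))).const_inner) hq).trans ?_
    gcongr with j
    exact eLpNorm_le_mul_eLpNorm_of_ae_le_mul (ae_of_all _ fun x => norm_inner_le_norm _ _) q
  refine tendsto_of_tendsto_of_tendsto_of_le_of_le tendsto_const_nhds ?_ (fun _ => zero_le) hbound
  simpa using tendsto_finsetSum Finset.univ fun j _ =>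
    ENNReal.Tendsto.const_mul (h (t j)) (Or.inr (ENNReal.ofReal_ne_top (r := ‖θ j‖)))

end LinComb

section FddCharFun

variable {Ω Ω' J : Type*} [MeasurableSpace Ω] [MeasurableSpace Ω'] [Fintype J] {p : ℕ}
  {P : Measure Ω} {P' : Measure Ω'} {X : ℝ → Ω → EuclideanSpace ℝ (Fin p)}
  {Y : ℝ → Ω' → EuclideanSpace ℝ (Fin p)}

/-- The joint characteristic function of `X (tⱼ)`, `j : J`, at the frequencies `θⱼ`. -/
def fddCharFun (P : Measure Ω) (X : ℝ → Ω → EuclideanSpace ℝ (Fin p)) (t : J → ℝ)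
    (θ : J → EuclideanSpace ℝ (Fin p)) : ℂ :=
  ∫ ω, Complex.exp (linComb X t θ ω * Complex.I) ∂P

theorem aemeasurable_linComb (hX : ∀ t, AEMeasurable (X t) P) (t : J → ℝ)
    (θ : J → EuclideanSpace ℝ (Fin p)) : AEMeasurable (linComb X t θ) P :=
  Finset.aemeasurable_fun_sum _ fun j _ => (hX (t j)).const_inner

theorem aemeasurable_restrict (hX : ∀ t, AEMeasurable (X t) P) (I : Finset ℝ) :
    AEMeasurable (fun ω => I.restrict (fun t => X t ω)) P :=
  aemeasurable_pi_lambda _ fun i => hX i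

theorem aemeasurable_toLp_restrict (hX : ∀ t, AEMeasurable (X t) P) (I : Finset ℝ) :
    AEMeasurable (fun ω => WithLp.toLp 2 (I.restrict (fun t => X t ω))) P :=
  (WithLp.measurable_toLp 2 _).comp_aemeasurable (aemeasurable_restrict hX I)

theorem charFun_map_toLp_restrict (hX : ∀ t, AEMeasurable (X t) P) (I : Finset ℝ)
    (θ : PiLp 2 (fun _ : I => EuclideanSpace ℝ (Fin p))) :
    charFun (P.map (fun ω => WithLp.toLp 2 (I.restrict (fun t => X t ω)))) θ =
      fddCharFun P X (fun i : I => (i : ℝ)) (fun i => θ i) := by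
  rw [charFun_apply, integral_map (aemeasurable_toLp_restrict hX I) (by fun_prop)]
  simp [fddCharFun, linComb, PiLp.inner_apply, mul_comm]

theorem FddEq.aemeasurable_left (h : FddEq P X P' Y) (t : ℝ) : AEMeasurable (X t) P :=
  (measurable_pi_apply (⟨t, by simp⟩ : ({t} : Finset ℝ))).comp_aemeasurable
    (h {t}).aemeasurable_fst

theorem FddEq.fddCharFun_eq (h : FddEq P X P' Y) (t : J → ℝ) (θ : J → EuclideanSpace ℝ (Fin p)) :
    fddCharFun P X t θ = fddCharFun P' Y t θ := by
  classical
  let I : Finset ℝ := Finset.univ.image t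
  have ht : ∀ j, t j ∈ I := fun j => Finset.mem_image_of_mem _ (Finset.mem_univ j)
  let f : (I → EuclideanSpace ℝ (Fin p)) → ℂ := fun x =>
    Complex.exp ((∑ j, inner ℝ (θ j) (x ⟨t j, ht j⟩) : ℝ) * Complex.I)
  have hf : Measurable f := by fun_prop
  exact ((h I).comp hf).integral_eq

theorem fddEq_of_fddCharFun_eq [IsFiniteMeasure P] [IsFiniteMeasure P']
    (hX : ∀ t, AEMeasurable (X t) P) (hY : ∀ t, AEMeasurable (Y t) P')
    (h : ∀ (I : Finset ℝ) (θ : I → EuclideanSpace ℝ (Fin p)),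
      fddCharFun P X (fun i : I => (i : ℝ)) θ = fddCharFun P' Y (fun i : I => (i : ℝ)) θ) :
    FddEq P X P' Y := by
  intro I
  refine ⟨aemeasurable_restrict hX I, aemeasurable_restrict hY I, ?_⟩
  apply (MeasurableEquiv.toLp 2 (I → EuclideanSpace ℝ (Fin p))).map_measurableEquiv_injective
  rw [AEMeasurable.map_map_of_aemeasurable (by fun_prop) (aemeasurable_restrict hX I),
    AEMeasurable.map_map_of_aemeasurable (by fun_prop) (aemeasurable_restrict hY I)]
  refine Measure.ext_of_charFun (μ := P.map (fun ω => WithLp.toLp 2 (I.restrict (fun t => X t ω))))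
    (ν := P'.map (fun ω => WithLp.toLp 2 (I.restrict (fun t => Y t ω)))) ?_
  funext θ
  rw [charFun_map_toLp_restrict hX, charFun_map_toLp_restrict hY]
  exact h I _

theorem isGaussianProcess_of_map_linComb (hX : ∀ t, AEMeasurable (X t) P)
    (h : ∀ (I : Finset ℝ) (θ : I → EuclideanSpace ℝ (Fin p)), ∃ v : ℝ≥0,
      P.map (linComb X (fun i : I => (i : ℝ)) θ) = gaussianReal 0 v) :
    IsGaussianProcess X P := by
  classical
  refine ⟨fun I => ⟨isGaussian_of_map_eq_gaussianReal fun L => ?_⟩⟩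
  -- the Riesz representatives of the restrictions of `L` to the coordinate subspaces
  let θ : I → EuclideanSpace ℝ (Fin p) := fun i => (InnerProductSpace.toDual ℝ _).symm
    (L.comp (ContinuousLinearMap.single ℝ (fun _ : I => EuclideanSpace ℝ (Fin p)) i))
  have hL : ∀ x : I → EuclideanSpace ℝ (Fin p), L x = ∑ i, inner ℝ (θ i) (x i) := fun x => by
    simp only [θ, InnerProductSpace.toDual_symm_apply]
    rw [← Finset.univ_sum_single x, map_sum, Finset.univ_sum_single x]
    rfl
  obtain ⟨v, hv⟩ := h I θ
  refine ⟨0, v, ?_⟩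
  rw [AEMeasurable.map_map_of_aemeasurable (by fun_prop) (aemeasurable_restrict hX I), ← hv]
  exact congrArg P.map (funext fun ω => hL _)

theorem fddTendsto_of_tendsto_fddCharFun [IsProbabilityMeasure P] [IsProbabilityMeasure P']
    {X : ℝ → ℝ → Ω → EuclideanSpace ℝ (Fin p)} {l : Filter ℝ} [l.IsCountablyGenerated]
    (hX : ∀ c t, AEMeasurable (X c t) P) (hY : ∀ t, AEMeasurable (Y t) P')
    (h : ∀ (I : Finset ℝ) (θ : I → EuclideanSpace ℝ (Fin p)),
      Tendsto (fun c => fddCharFun P (X c) (fun i : I => (i : ℝ)) θ) l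
        (𝓝 (fddCharFun P' Y (fun i : I => (i : ℝ)) θ))) :
    FddTendsto P X l P' Y := by
  intro I
  have htoLp : TendstoInDistribution
      (fun c ω => WithLp.toLp 2 (I.restrict (fun t => X c t ω))) l
      (fun ω => WithLp.toLp 2 (I.restrict (fun t => Y t ω))) (fun _ => P) P' := by
    refine ⟨fun c => aemeasurable_toLp_restrict (hX c) I, aemeasurable_toLp_restrict hY I,
      tendsto_of_seq_tendsto fun c hc => ?_⟩
    refine ProbabilityMeasure.tendsto_of_tendsto_charFun fun θ => ?_
    have hlim := (h I (fun i => θ i)).comp hc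
    rw [← charFun_map_toLp_restrict hY] at hlim
    exact hlim.congr fun n => (charFun_map_toLp_restrict (hX (c n)) I θ).symm
  exact htoLp.continuous_comp (g := WithLp.ofLp) (by fun_prop)

end FddCharFun

section CompExp

/-- The compensated exponential `e^{iu} - 1 - iu`, the integrand of the characteristic exponent of a
compensated Poisson integral. -/
def compExp (u : ℝ) : ℂ := Complex.exp (u * Complex.I) - 1 - u * Complex.I

@[simp]
theorem compExp_zero : compExp 0 = 0 := by simp [compExp]

@[fun_prop]
theorem continuous_compExp : Continuous compExp := by unfold compExp; fun_prop

theorem hasDerivAt_compExp (x : ℝ) :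
    HasDerivAt compExp ((Complex.exp (x * Complex.I) - 1) * Complex.I) x := by
  have hlin : HasDerivAt (fun y : ℝ => (y : ℂ) * Complex.I) Complex.I x := by
    simpa using (Complex.ofRealCLM.hasDerivAt (x := x)).mul_const Complex.I
  convert! (hlin.cexp.sub_const 1).sub hlin using 1
  ring

theorem norm_le_abs_pow_succ_of_hasDerivAt {E : Type*} [NormedAddCommGroup E] [NormedSpace ℝ E]
    {f f' : ℝ → E} {n : ℕ} (hf : ∀ x, HasDerivAt f (f' x) x) (hf' : ∀ x, ‖f' x‖ ≤ |x| ^ n)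
    (hf0 : f 0 = 0) (u : ℝ) : ‖f u‖ ≤ |u| ^ (n + 1) := by
  have h := Convex.norm_image_sub_le_of_norm_hasDerivWithin_le (f := f)
    (s := Set.Icc (-|u|) |u|) (x := 0) (y := u) (C := |u| ^ n)
    (fun x _ => (hf x).hasDerivWithinAt)
    (fun x hx => (hf' x).trans (pow_le_pow_left₀ (abs_nonneg x) (abs_le.2 hx) n))
    (convex_Icc _ _) (by simp) ⟨neg_abs_le u, le_abs_self u⟩
  simpa [hf0, pow_succ] using h

theorem norm_exp_mul_I_sub_one_le (u : ℝ) : ‖Complex.exp (u * Complex.I) - 1‖ ≤ |u| := by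
  rw [mul_comm]
  exact Real.norm_exp_I_mul_ofReal_sub_one_le

theorem norm_exp_mul_I_sub_exp_mul_I_le (u v : ℝ) :
    ‖Complex.exp (u * Complex.I) - Complex.exp (v * Complex.I)‖ ≤ |u - v| := by
  have hfactor : Complex.exp (u * Complex.I) - Complex.exp (v * Complex.I)
      = Complex.exp (v * Complex.I) * (Complex.exp ((u - v : ℝ) * Complex.I) - 1) := by
    rw [mul_sub, ← Complex.exp_add, mul_one]
    congr 2
    push_cast
    ring
  rw [hfactor, norm_mul, Complex.norm_exp_ofReal_mul_I, one_mul]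
  exact norm_exp_mul_I_sub_one_le _

theorem norm_compExp_le (u : ℝ) : ‖compExp u‖ ≤ u ^ 2 := by
  rw [← sq_abs]
  refine norm_le_abs_pow_succ_of_hasDerivAt (n := 1) hasDerivAt_compExp (fun x => ?_)
    compExp_zero u
  simpa using norm_exp_mul_I_sub_one_le x

theorem norm_compExp_add_sq_div_two_le (u : ℝ) : ‖compExp u + (u : ℂ) ^ 2 / 2‖ ≤ |u| ^ 3 := by
  refine norm_le_abs_pow_succ_of_hasDerivAt (n := 2) (f := fun u => compExp u + (u : ℂ) ^ 2 / 2)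
    (f' := fun x => compExp x * Complex.I) (fun x => ?_) (fun x => ?_) (by simp) u
  · have hsq : HasDerivAt (fun y : ℝ => (y : ℂ) ^ 2 / 2) (x : ℂ) x := by
      simpa using ((Complex.ofRealCLM.hasDerivAt (x := x)).pow 2).div_const 2
    convert! (hasDerivAt_compExp x).add hsq using 1
    simp only [compExp]
    linear_combination -(x : ℂ) * Complex.I_sq
  · simpa using norm_compExp_le x

theorem norm_compExp_sub_le (u v : ℝ) :
    ‖compExp u - compExp v‖ ≤ |u - v| * (|u - v| + |v|) := by
  have hsplit : compExp u - compExp v = Complex.exp (v * Complex.I) * compExp (u - v)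
      + (u - v : ℝ) * Complex.I * (Complex.exp (v * Complex.I) - 1) := by
    have hexp : Complex.exp (u * Complex.I)
        = Complex.exp (v * Complex.I) * Complex.exp ((u - v : ℝ) * Complex.I) := by
      rw [← Complex.exp_add]
      congr 1
      push_cast
      ring
    simp only [compExp]
    rw [hexp]
    push_cast
    ring
  rw [hsplit]
  refine (norm_add_le _ _).trans ?_
  rw [norm_mul, norm_mul, norm_mul, Complex.norm_exp_ofReal_mul_I, Complex.norm_I,
    Complex.norm_real, Real.norm_eq_abs, mul_add, one_mul, mul_one, ← sq, sq_abs]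
  gcongr
  · exact norm_compExp_le _
  · exact norm_exp_mul_I_sub_one_le v

end CompExp

section L2Continuity

variable {S ι : Type*} [MeasurableSpace S] {ν : Measure S} {l : Filter ι} {f : S → ℝ}
  {F : ι → S → ℝ}

theorem integrable_compExp_comp (hf : MemLp f 2 ν) : Integrable (fun x => compExp (f x)) ν :=
  hf.integrable_sq.mono' (continuous_compExp.comp_aestronglyMeasurable hf.1)
    (ae_of_all _ fun _ => norm_compExp_le _)

theorem eLpNorm_compExp_sub_le (hf : AEStronglyMeasurable f ν) {g : S → ℝ}
    (hg : AEStronglyMeasurable g ν) :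
    eLpNorm ((fun x => compExp (f x)) - fun x => compExp (g x)) 1 ν
      ≤ eLpNorm (f - g) 2 ν * (eLpNorm (f - g) 2 ν + eLpNorm g 2 ν) := by
  have hd : AEStronglyMeasurable (f - g) ν := hf.sub hg
  calc eLpNorm ((fun x => compExp (f x)) - fun x => compExp (g x)) 1 ν
      ≤ eLpNorm ((f - g) • (fun x => ‖(f - g) x‖ + ‖g x‖)) 1 ν := by
        refine eLpNorm_mono fun x => ?_
        simp only [Pi.sub_apply, Pi.smul_apply', smul_eq_mul, norm_mul, Real.norm_eq_abs]
        rw [abs_of_nonneg (by positivity : 0 ≤ |f x - g x| + |g x|)]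
        exact norm_compExp_sub_le _ _
    _ ≤ eLpNorm (f - g) 2 ν * eLpNorm (fun x => ‖(f - g) x‖ + ‖g x‖) 2 ν :=
        eLpNorm_smul_le_mul_eLpNorm (hd.norm.add hg.norm) hd
    _ ≤ eLpNorm (f - g) 2 ν * (eLpNorm (f - g) 2 ν + eLpNorm g 2 ν) := by
        gcongr
        refine (eLpNorm_add_le hd.norm hg.norm (by norm_num)).trans ?_
        rw [eLpNorm_norm, eLpNorm_norm]

theorem tendsto_integral_compExp (hf : MemLp f 2 ν) (hF : ∀ n, MemLp (F n) 2 ν)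
    (h : Tendsto (fun n => eLpNorm (F n - f) 2 ν) l (𝓝 0)) :
    Tendsto (fun n => ∫ x, compExp (F n x) ∂ν) l (𝓝 (∫ x, compExp (f x) ∂ν)) := by
  refine tendsto_integral_of_L1' _ (integrable_compExp_comp hf).1
    (Eventually.of_forall fun n => integrable_compExp_comp (hF n)) ?_
  refine tendsto_of_tendsto_of_tendsto_of_le_of_le tendsto_const_nhds ?_ (fun _ => zero_le)
    fun n => eLpNorm_compExp_sub_le (hF n).1 hf.1
  simpa using ENNReal.Tendsto.mul h (Or.inr (by simp [hf.2.ne]))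
    (h.add_const (eLpNorm f 2 ν)) (Or.inr (by simp))

theorem tendsto_integral_exp_mul_I [IsProbabilityMeasure ν] (hf : AEStronglyMeasurable f ν)
    (hF : ∀ n, AEStronglyMeasurable (F n) ν)
    (h : Tendsto (fun n => eLpNorm (F n - f) 2 ν) l (𝓝 0)) :
    Tendsto (fun n => ∫ x, Complex.exp (F n x * Complex.I) ∂ν) l
      (𝓝 (∫ x, Complex.exp (f x * Complex.I) ∂ν)) := by
  have hint : ∀ {g : S → ℝ}, AEStronglyMeasurable g ν →
      Integrable (fun x => Complex.exp (g x * Complex.I)) ν := fun {g} hg =>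
    Integrable.of_bound ((by fun_prop : Continuous fun u : ℝ =>
      Complex.exp (u * Complex.I)).comp_aestronglyMeasurable hg) 1
      (ae_of_all _ fun x => by simp [Complex.norm_exp_ofReal_mul_I])
  refine tendsto_integral_of_L1' _ (hint hf).1 (Eventually.of_forall fun n => hint (hF n)) ?_
  exact tendsto_of_tendsto_of_tendsto_of_le_of_le tendsto_const_nhds h (fun _ => zero_le)
    fun n => (eLpNorm_mono (g := F n - f) fun _ => norm_exp_mul_I_sub_exp_mul_I_le _ _).trans
      (eLpNorm_le_eLpNorm_of_exponent_le (by norm_num) ((hF n).sub hf))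

end L2Continuity

section Poisson

variable {Ω S ι : Type*} [MeasurableSpace Ω] [MeasurableSpace S] [Fintype ι] {P : Measure Ω}
  {N : Ω → Measure S} {ν : Measure S}

theorem IsPoissonRandomMeasure.ae_ne_top (hN : IsPoissonRandomMeasure P N ν) {B : Set S}
    (hB : MeasurableSet B) (hν : ν B ≠ ∞) : ∀ᵐ ω ∂P, N ω B ≠ ∞ := by
  have h : ∀ᵐ x ∂(P.map (fun ω => N ω B)), x ≠ ∞ := by
    rw [hN.law B hB hν]
    exact (ae_map_iff Measurable.of_discrete.aemeasurable
      (measurableSet_singleton (∞ : ℝ≥0∞)).compl).2 (by simp)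
  exact ae_of_ae_map (hN.measurable B hB).aemeasurable h

theorem IsPoissonRandomMeasure.measurable_compensated (hN : IsPoissonRandomMeasure P N ν)
    {B : Set S} (hB : MeasurableSet B) : Measurable (compensated N ν B) :=
  (hN.measurable B hB).ennreal_toReal.sub_const _

theorem IsPoissonRandomMeasure.iIndepFun {κ : Type*} [Finite κ]
    (hN : IsPoissonRandomMeasure P N ν) {B : κ → Set S} (hB : ∀ i, MeasurableSet (B i))
    (hdisj : Pairwise (Function.onFun Disjoint B)) : iIndepFun (fun i ω => N ω (B i)) P := by
  let e := Finite.equivFin κ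
  have h := hN.indep _ (fun i => B (e.symm i)) (fun i => hB _)
    fun i j hij => hdisj (e.symm.injective.ne hij)
  simpa using h.precomp e.injective

theorem IsPoissonRandomMeasure.integral_exp_compensated (hN : IsPoissonRandomMeasure P N ν)
    {B : Set S} (hB : MeasurableSet B) (hν : ν B ≠ ∞) (c : ℝ) :
    ∫ ω, Complex.exp ((c * compensated N ν B ω : ℝ) * Complex.I) ∂P
      = Complex.exp (ν.real B * compExp c) := by
  let g : ℝ≥0∞ → ℂ := fun x => Complex.exp ((c * (x.toReal - (ν B).toReal) : ℝ) * Complex.I)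
  have hg : AEStronglyMeasurable g (P.map (fun ω => N ω B)) :=
    Measurable.aestronglyMeasurable (by fun_prop)
  have hcount : ∀ k : ℕ, g k = Complex.exp ((c * k : ℝ) * Complex.I)
      * Complex.exp (-(c * ν.real B * Complex.I)) := fun k => by
    simp only [g, ENNReal.toReal_natCast, ← Complex.exp_add, Measure.real]
    congr 1
    push_cast
    ring
  calc ∫ ω, g (N ω B) ∂P
      = ∫ k : ℕ, g k ∂(poissonMeasure (ν B).toNNReal) := by
        rw [← integral_map (hN.measurable B hB).aemeasurable hg]
        rw [hN.law B hB hν] at hg ⊢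
        exact integral_map Measurable.of_discrete.aemeasurable hg
    _ = charFun ((poissonMeasure (ν B).toNNReal).map (fun k : ℕ => (k : ℝ))) c
          * Complex.exp (-(c * ν.real B * Complex.I)) := by
        simp_rw [hcount]
        rw [integral_mul_const, charFun_apply_real,
          integral_map Measurable.of_discrete.aemeasurable (by fun_prop)]
        simp
    _ = Complex.exp (ν.real B * compExp c) := by
        rw [charFun_map_cast_poissonMeasure, ← Complex.exp_add]
        congr 1
        simp only [compExp, ENNReal.coe_toNNReal_eq_toReal, Measure.real]
        ring

theorem IsPoissonRandomMeasure.integral_exp_sum_compensated_of_disjoint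
    (hN : IsPoissonRandomMeasure P N ν) {B : ι → Set S} (hB : ∀ i, MeasurableSet (B i))
    (hdisj : Pairwise (Function.onFun Disjoint B)) (hν : ∀ i, ν (B i) ≠ ∞) (a : ι → ℝ) :
    ∫ ω, Complex.exp ((∑ i, a i * compensated N ν (B i) ω : ℝ) * Complex.I) ∂P
      = Complex.exp (∑ i, ν.real (B i) * compExp (a i)) := by
  have hprod := (hN.iIndepFun hB hdisj).integral_fun_prod_comp (f := fun i (x : ℝ≥0∞) =>
      Complex.exp ((a i * (x.toReal - (ν (B i)).toReal) : ℝ) * Complex.I))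
    (fun i => (hN.measurable _ (hB i)).aemeasurable)
    (fun i => Measurable.aestronglyMeasurable (by fun_prop))
  simp_rw [Complex.exp_sum, ← hN.integral_exp_compensated (hB _) (hν _)]
  refine Eq.trans ?_ hprod
  simp only [Complex.ofReal_sum, Finset.sum_mul, Complex.exp_sum, compensated]

theorem integral_comp_simpleFunc_eq_sum {F : Type*} [NormedAddCommGroup F] [NormedSpace ℝ F]
    [CompleteSpace F] {m : Measure S} {f : SimpleFunc S ℝ}
    (hm : ∀ c ∈ f.range.filter (· ≠ 0), m (f ⁻¹' {c}) ≠ ∞) {g : ℝ → F} (hg : g 0 = 0) :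
    ∫ x, g (f x) ∂m = ∑ c : {c // c ∈ f.range.filter (· ≠ 0)}, m.real (f ⁻¹' {(c : ℝ)}) • g c := by
  have hf : Integrable f m := by
    refine SimpleFunc.integrable_iff.2 fun y hy => ?_
    by_cases hyr : y ∈ f.range
    · exact (hm y (Finset.mem_filter.2 ⟨hyr, hy⟩)).lt_top
    · simp [(SimpleFunc.preimage_eq_empty_iff f y).2 (by simpa using hyr)]
  have hgf : Integrable (f.map g) m := SimpleFunc.integrable_iff_finMeasSupp.2
    ((SimpleFunc.integrable_iff_finMeasSupp.1 hf).map hg)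
  rw [Finset.sum_coe_sort _ (fun c => m.real (f ⁻¹' {c}) • g c), Finset.sum_filter_of_ne]
  · exact (SimpleFunc.integral_eq_integral _ hgf).symm.trans (SimpleFunc.map_integral f g hf hg)
  · rintro c - hc rfl
    simp [hg] at hc

theorem IsPoissonRandomMeasure.integral_exp_simpleFunc (hN : IsPoissonRandomMeasure P N ν)
    {f : SimpleFunc S ℝ} (hf : Integrable f ν) :
    ∫ ω, Complex.exp (((∫ x, f x ∂(N ω)) - ∫ x, f x ∂ν : ℝ) * Complex.I) ∂P
      = Complex.exp (∫ x, compExp (f x) ∂ν) := by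
  have hν : ∀ c ∈ f.range.filter (· ≠ 0), ν (f ⁻¹' {c}) ≠ ∞ := fun c hc =>
    (f.measure_preimage_lt_top_of_integrable hf (Finset.mem_filter.1 hc).2).ne
  have hNω : ∀ᵐ ω ∂P, ∀ c ∈ f.range.filter (· ≠ 0), N ω (f ⁻¹' {c}) ≠ ∞ :=
    (Filter.eventually_all_finset _).2 fun c hc => hN.ae_ne_top (f.measurableSet_fiber c) (hν c hc)
  have hdisj : Pairwise (Function.onFun Disjoint
      fun c : {c // c ∈ f.range.filter (· ≠ 0)} => f ⁻¹' {(c : ℝ)}) := fun c d hcd =>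
    Disjoint.preimage _ (Set.disjoint_singleton.2 fun h => hcd (Subtype.ext h))
  rw [integral_comp_simpleFunc_eq_sum hν compExp_zero]
  simp_rw [Complex.real_smul]
  rw [← hN.integral_exp_sum_compensated_of_disjoint (fun c => f.measurableSet_fiber _) hdisj
    fun c => hν c c.2]
  refine integral_congr_ae ?_
  filter_upwards [hNω] with ω hω
  rw [integral_comp_simpleFunc_eq_sum (g := fun x => x) hω rfl,
    integral_comp_simpleFunc_eq_sum (g := fun x => x) hν rfl, ← Finset.sum_sub_distrib]
  congr! 4 with c
  simp only [compensated, smul_eq_mul, Measure.real]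
  ring

theorem coe_simpleFunc_sum {F : Type*} [AddCommMonoid F] (f : ι → SimpleFunc S F) :
    ⇑(∑ i, f i) = ∑ i, ⇑(f i) :=
  map_sum ({ toFun := (⇑), map_zero' := rfl, map_add' := fun _ _ => rfl } :
    SimpleFunc S F →+ (S → F)) f Finset.univ

theorem IsPoissonRandomMeasure.integral_exp_sum_compensated (hN : IsPoissonRandomMeasure P N ν)
    {B : ι → Set S} (hB : ∀ i, MeasurableSet (B i)) (hν : ∀ i, ν (B i) ≠ ∞) (a : ι → ℝ) :
    ∫ ω, Complex.exp ((∑ i, a i * compensated N ν (B i) ω : ℝ) * Complex.I) ∂P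
      = Complex.exp (∫ x, compExp (∑ i, (B i).indicator (fun _ => a i) x) ∂ν) := by
  let f : SimpleFunc S ℝ := ∑ i, (SimpleFunc.const S (a i)).restrict (B i)
  have hf : ∀ x, f x = ∑ i, (B i).indicator (fun _ => a i) x := fun x => by
    simp only [f, coe_simpleFunc_sum, Finset.sum_apply, SimpleFunc.coe_restrict _ (hB _)]
    rfl
  have hint : ∀ m : Measure S, (∀ i, m (B i) ≠ ∞) →
      ∀ i, Integrable ((B i).indicator fun _ => a i) m := fun m hm i =>
    (integrable_indicator_iff (hB i)).2 (integrableOn_const (hm i))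
  have hsum : ∀ m : Measure S, (∀ i, m (B i) ≠ ∞) → ∫ x, f x ∂m = ∑ i, m.real (B i) * a i :=
    fun m hm => by
      simp_rw [hf]
      rw [integral_finsetSum _ fun i _ => hint m hm i]
      simp [integral_indicator (hB _)]
  have hNω : ∀ᵐ ω ∂P, ∀ i, N ω (B i) ≠ ∞ := ae_all_iff.2 fun i => hN.ae_ne_top (hB i) (hν i)
  simp_rw [← hf]
  rw [← hN.integral_exp_simpleFunc]
  · refine integral_congr_ae ?_
    filter_upwards [hNω] with ω hω
    rw [hsum _ hω, hsum _ hν, ← Finset.sum_sub_distrib]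
    congr! 4 with i
    simp only [compensated, Measure.real]
    ring
  · exact (integrable_finsetSum _ fun i _ => hint ν hν i).congr (ae_of_all _ fun x => (hf x).symm)

end Poisson

section StochIntegral

variable {Ω Z J : Type*} [MeasurableSpace Ω] [MeasurableSpace Z] [Fintype J] {p : ℕ}
  {P : Measure Ω} {N : Ω → Measure (ℝ × Z)} {ν : Measure (ℝ × Z)}

theorem Elementary.measurableSet_prod (e : Elementary ν p) (i : Fin e.size) :
    MeasurableSet (e.left i ×ˢ e.right i) :=
  (e.measurableSet_left i).prod (e.measurableSet_right i)

theorem Elementary.memLp_toFun (e : Elementary ν p) (q : ℝ≥0∞) : MemLp e.toFun q ν :=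
  memLp_finsetSum _ fun i _ =>
    memLp_indicator_const _ (e.measurableSet_prod i) _ (Or.inr (e.finite i))

theorem Elementary.measurable_integral (e : Elementary ν p) (hN : IsPoissonRandomMeasure P N ν) :
    Measurable (e.integral N) :=
  Finset.measurable_sum _ fun i _ =>
    (hN.measurable_compensated (e.measurableSet_prod i)).smul_const _

theorem fddCharFun_elementary_integral (hN : IsPoissonRandomMeasure P N ν)
    (e : ℝ → Elementary ν p) (t : J → ℝ) (θ : J → EuclideanSpace ℝ (Fin p)) :
    fddCharFun P (fun s => (e s).integral N) t θ
      = Complex.exp (∫ x, compExp (linComb (fun s => (e s).toFun) t θ x) ∂ν) := by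
  let B : (Σ j, Fin (e (t j)).size) → Set (ℝ × Z) := fun k =>
    (e (t k.1)).left k.2 ×ˢ (e (t k.1)).right k.2
  let a : (Σ j, Fin (e (t j)).size) → ℝ := fun k => inner ℝ (θ k.1) ((e (t k.1)).coef k.2)
  have hintegral : ∀ ω, linComb (fun s => (e s).integral N) t θ ω
      = ∑ k, a k * compensated N ν (B k) ω := fun ω => by
    simp only [linComb, Elementary.integral, inner_sum, inner_smul_right, Fintype.sum_sigma, a, B]
    simp only [mul_comm]
  have htoFun : ∀ x, linComb (fun s => (e s).toFun) t θ x
      = ∑ k, (B k).indicator (fun _ => a k) x := fun x => by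
    classical
    simp only [linComb, Elementary.toFun, inner_sum, Fintype.sum_sigma, Set.indicator_apply,
      apply_ite (inner ℝ _), inner_zero_right, a, B]
  simp_rw [fddCharFun, hintegral, htoFun]
  exact hN.integral_exp_sum_compensated (fun k => (e _).measurableSet_prod _)
    (fun k => (e _).finite _) a

theorem fddCharFun_of_isStochIntegral [IsProbabilityMeasure P] (hN : IsPoissonRandomMeasure P N ν)
    {φ : ℝ → ℝ × Z → EuclideanSpace ℝ (Fin p)} {Y : ℝ → Ω → EuclideanSpace ℝ (Fin p)}
    (hY : ∀ t, IsStochIntegral P N ν (φ t) (Y t)) (t : J → ℝ)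
    (θ : J → EuclideanSpace ℝ (Fin p)) :
    fddCharFun P Y t θ = Complex.exp (∫ x, compExp (linComb φ t θ x) ∂ν) := by
  choose hφ hYL e heφ heY using hY
  have hmeas : ∀ n s, AEStronglyMeasurable ((e s n).integral N) P := fun n s =>
    ((e s n).measurable_integral hN).aestronglyMeasurable
  have hexponent := tendsto_integral_compExp (memLp_linComb hφ t θ)
    (fun n => memLp_linComb (fun s => (e s n).memLp_toFun 2) t θ)
    (tendsto_eLpNorm_linComb_sub one_le_two (fun n s => ((e s n).memLp_toFun 2).1)
      (fun s => (hφ s).1) heφ t θ)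
  have hcharFun := tendsto_integral_exp_mul_I (memLp_linComb hYL t θ).1
    (fun n => (Finset.aestronglyMeasurable_fun_sum _ fun j _ => (hmeas n (t j)).const_inner :
      AEStronglyMeasurable (linComb (fun s => (e s n).integral N) t θ) P))
    (tendsto_eLpNorm_linComb_sub one_le_two hmeas (fun s => (hYL s).1) heY t θ)
  refine tendsto_nhds_unique hcharFun (((Complex.continuous_exp.tendsto _).comp hexponent).congr
    fun n => ?_)
  exact (fddCharFun_elementary_integral hN (fun s => e s n) t θ).symm

end StochIntegral

section CharFunctional

variable {Ω Ω' S S' : Type*} [MeasurableSpace Ω] [MeasurableSpace Ω'] {p : ℕ}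
  {P : Measure Ω} {P' : Measure Ω'} {X : ℝ → Ω → EuclideanSpace ℝ (Fin p)}
  {Y : ℝ → Ω' → EuclideanSpace ℝ (Fin p)} {φ : ℝ → S → EuclideanSpace ℝ (Fin p)}
  {ψ : ℝ → S' → EuclideanSpace ℝ (Fin p)} {Ψ : (S → ℝ) → ℂ} {Ψ' : (S' → ℝ) → ℂ}

/-- `X` has the finite-dimensional distributions of the process of integrals `∫ φ t dM`, where `M`
is a random measure whose integrals of real functions `f` have the characteristic functional
`Ψ f = 𝔼 exp (i ∫ f dM)`. The random measure itself does not appear in the definition. -/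
structure HasCharFunctional (P : Measure Ω) (X : ℝ → Ω → EuclideanSpace ℝ (Fin p))
    (φ : ℝ → S → EuclideanSpace ℝ (Fin p)) (Ψ : (S → ℝ) → ℂ) : Prop where
  aemeasurable : ∀ t, AEMeasurable (X t) P
  fddCharFun_eq : ∀ {J : Type} [Fintype J] (t : J → ℝ) (θ : J → EuclideanSpace ℝ (Fin p)),
    fddCharFun P X t θ = Ψ (linComb φ t θ)

namespace HasCharFunctional

theorem comp_time (h : HasCharFunctional P X φ Ψ) (a : ℝ → ℝ) :
    HasCharFunctional P (fun t => X (a t)) (fun t => φ (a t)) Ψ where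
  aemeasurable t := h.aemeasurable (a t)
  fddCharFun_eq t := h.fddCharFun_eq (a ∘ t)

theorem map_linear (h : HasCharFunctional P X φ Ψ)
    (L : EuclideanSpace ℝ (Fin p) →ₗ[ℝ] EuclideanSpace ℝ (Fin p)) :
    HasCharFunctional P (fun t ω => L (X t ω)) (fun t x => L (φ t x)) Ψ where
  aemeasurable t := (LinearMap.continuous_of_finiteDimensional L).measurable.comp_aemeasurable
    (h.aemeasurable t)
  fddCharFun_eq t θ := by
    rw [fddCharFun, linComb_linearMap L X, linComb_linearMap L φ]
    exact h.fddCharFun_eq t _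

theorem sub (h : HasCharFunctional P X φ Ψ) (a b : ℝ → ℝ) :
    HasCharFunctional P (fun t ω => X (a t) ω - X (b t) ω)
      (fun t x => φ (a t) x - φ (b t) x) Ψ where
  aemeasurable t := (h.aemeasurable _).sub (h.aemeasurable _)
  fddCharFun_eq t θ := by
    rw [fddCharFun, linComb_sub X, linComb_sub φ]
    exact h.fddCharFun_eq _ _

theorem of_fddEq (h : HasCharFunctional P' Y φ Ψ) (hXY : FddEq P X P' Y) :
    HasCharFunctional P X φ Ψ where
  aemeasurable := hXY.aemeasurable_left
  fddCharFun_eq t θ := (hXY.fddCharFun_eq t θ).trans (h.fddCharFun_eq t θ)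

theorem congr_charFunctional (h : HasCharFunctional P X φ Ψ)
    (hΨ : ∀ {J : Type} [Fintype J] (t : J → ℝ) (θ : J → EuclideanSpace ℝ (Fin p)),
      Ψ (linComb φ t θ) = Ψ' (linComb ψ t θ)) : HasCharFunctional P X ψ Ψ' where
  aemeasurable := h.aemeasurable
  fddCharFun_eq t θ := (h.fddCharFun_eq t θ).trans (hΨ t θ)

theorem fddEq [IsFiniteMeasure P] [IsFiniteMeasure P'] (hX : HasCharFunctional P X φ Ψ)
    (hY : HasCharFunctional P' Y φ Ψ) : FddEq P X P' Y :=
  fddEq_of_fddCharFun_eq hX.aemeasurable hY.aemeasurable fun _ θ =>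
    (hX.fddCharFun_eq _ θ).trans (hY.fddCharFun_eq _ θ).symm

theorem charFun_map_linComb (h : HasCharFunctional P X φ Ψ) {J : Type} [Fintype J] (t : J → ℝ)
    (θ : J → EuclideanSpace ℝ (Fin p)) (r : ℝ) :
    charFun (P.map (linComb X t θ)) r = Ψ (r • linComb φ t θ) := by
  rw [charFun_apply_real, integral_map (aemeasurable_linComb h.aemeasurable t θ) (by fun_prop),
    ← linComb_smul, ← h.fddCharFun_eq, fddCharFun, linComb_smul]
  simp

theorem ae_inner_eq_zero_iff [IsProbabilityMeasure P] (h : HasCharFunctional P X φ Ψ) (t : ℝ)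
    (θ : EuclideanSpace ℝ (Fin p)) :
    (∀ᵐ ω ∂P, inner ℝ θ (X t ω) = 0) ↔ ∀ r : ℝ, Ψ (fun x => r * inner ℝ θ (φ t x)) = 1 := by
  have hm : AEMeasurable (fun ω => (inner ℝ θ (X t ω) : ℝ)) P := (h.aemeasurable t).const_inner
  have hchar : ∀ r : ℝ, charFun (P.map fun ω => (inner ℝ θ (X t ω) : ℝ)) r
      = Ψ (fun x => r * inner ℝ θ (φ t x)) := fun r => by
    have hlin := h.charFun_map_linComb (fun _ : Unit => t) (fun _ => θ) r
    rwa [linComb_unit, linComb_unit] at hlin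
  have _ := Measure.isProbabilityMeasure_map hm
  simp_rw [← hchar]
  constructor
  · intro hzero r
    have hzero' : (fun ω => (inner ℝ θ (X t ω) : ℝ)) =ᵐ[P] fun _ => 0 := hzero
    simp [Measure.map_congr hzero']
  · intro hone
    have hdirac : P.map (fun ω => (inner ℝ θ (X t ω) : ℝ)) = Measure.dirac 0 :=
      Measure.ext_of_charFun (funext fun r => by simp [hone])
    exact ae_of_ae_map (p := fun x => x = 0) hm (by simp [hdirac])

end HasCharFunctional

theorem isProper_iff_forall_not_ae_inner_eq_zero : IsProper P X ↔
    ∀ t, t ≠ 0 → ∀ θ : EuclideanSpace ℝ (Fin p), θ ≠ 0 →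
      ¬ ∀ᵐ ω ∂P, inner ℝ θ (X t ω) = 0 := by
  constructor
  · intro h t ht θ hθ hzero
    refine h t ht (ℝ ∙ θ)ᗮ ?_ ?_
    · rwa [Ne, Submodule.orthogonal_eq_top_iff, Submodule.span_singleton_eq_bot]
    · simpa only [Submodule.mem_orthogonal_singleton_iff_inner_right] using hzero
  · intro h t ht V hV hmem
    obtain ⟨θ, hθV, hθ⟩ := Submodule.exists_mem_ne_zero_of_ne_bot
      (mt Submodule.orthogonal_eq_bot_iff.1 hV)
    exact h t ht θ hθ (hmem.mono fun ω hω => Submodule.inner_left_of_mem_orthogonal hω hθV)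

end CharFunctional

section PoissonGaussian

variable {Ω Ω' S : Type*} [MeasurableSpace Ω] [MeasurableSpace Ω'] [MeasurableSpace S] {p : ℕ}
  {P : Measure Ω} {Q : Measure Ω'} {X : ℝ → Ω → EuclideanSpace ℝ (Fin p)}
  {B : ℝ → Ω' → EuclideanSpace ℝ (Fin p)} {ν : Measure S}
  {φ : ℝ → S → EuclideanSpace ℝ (Fin p)} {f : S → ℝ}

/-- The characteristic functional of a compensated Poisson random measure with intensity `ν`. -/
def poissonCharFunctional (ν : Measure S) (f : S → ℝ) : ℂ :=
  Complex.exp (∫ x, compExp (f x) ∂ν)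

/-- The characteristic functional of a Gaussian white noise with control measure `ν`. -/
def gaussianCharFunctional (ν : Measure S) (f : S → ℝ) : ℂ :=
  Complex.exp (-((∫ x, f x ^ 2 ∂ν : ℝ) : ℂ) / 2)

theorem poissonCharFunctional_congr_ae {g : S → ℝ} (h : f =ᵐ[ν] g) :
    poissonCharFunctional ν f = poissonCharFunctional ν g := by
  unfold poissonCharFunctional
  rw [integral_congr_ae (h.mono fun x hx => congrArg compExp hx)]

theorem gaussianCharFunctional_eq_one_iff (hf : MemLp f 2 ν) :
    gaussianCharFunctional ν f = 1 ↔ f =ᵐ[ν] 0 := by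
  have hsq : (∫ x, f x ^ 2 ∂ν) = 0 ↔ f =ᵐ[ν] 0 := by
    rw [integral_eq_zero_iff_of_nonneg (fun _ => sq_nonneg _) hf.integrable_sq]
    exact eventually_congr (ae_of_all _ fun x => by simp)
  rw [← hsq, gaussianCharFunctional, ← Complex.ofReal_neg, ← Complex.ofReal_ofNat,
    ← Complex.ofReal_div, ← Complex.ofReal_exp, Complex.ofReal_eq_one, Real.exp_eq_one_iff]
  simp

theorem HasCharFunctional.map_linComb_eq_gaussianReal [IsProbabilityMeasure Q]
    (h : HasCharFunctional Q B φ (gaussianCharFunctional ν)) {J : Type} [Fintype J] (t : J → ℝ)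
    (θ : J → EuclideanSpace ℝ (Fin p)) :
    Q.map (linComb B t θ) = gaussianReal 0 (∫ x, linComb φ t θ x ^ 2 ∂ν).toNNReal := by
  have _ := Measure.isProbabilityMeasure_map (aemeasurable_linComb h.aemeasurable t θ)
  refine Measure.ext_of_charFun (funext fun r => ?_)
  rw [h.charFun_map_linComb, charFun_gaussianReal, gaussianCharFunctional,
    Real.coe_toNNReal _ (integral_nonneg fun _ => sq_nonneg _)]
  simp only [Pi.smul_apply, smul_eq_mul, mul_pow, integral_const_mul]
  congr 1
  push_cast
  ring

theorem IsProper.gaussian_of_poisson [IsProbabilityMeasure P] [IsProbabilityMeasure Q]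
    (hproper : IsProper P X) (hφ : ∀ t, MemLp (φ t) 2 ν)
    (hX : HasCharFunctional P X φ (poissonCharFunctional ν))
    (hB : HasCharFunctional Q B φ (gaussianCharFunctional ν)) : IsProper Q B := by
  rw [isProper_iff_forall_not_ae_inner_eq_zero] at hproper ⊢
  intro t ht θ hθ hzero
  have hφ_zero : (fun x => (inner ℝ θ (φ t x) : ℝ)) =ᵐ[ν] 0 := by
    rw [← gaussianCharFunctional_eq_one_iff ((hφ t).const_inner θ)]
    simpa using (hB.ae_inner_eq_zero_iff t θ).1 hzero 1
  refine hproper t ht θ hθ ((hX.ae_inner_eq_zero_iff t θ).2 fun r => ?_)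
  rw [poissonCharFunctional_congr_ae (g := 0) (hφ_zero.mono fun x hx => by simp [hx])]
  simp [poissonCharFunctional]

/-- The covariance identities that make a Gaussian process with kernels `φ` and control measure
`ν` operator self-similar with exponent `H` and give it stationary increments. -/
structure HasFractionalCovariance (ν : Measure S) (φ : ℝ → S → EuclideanSpace ℝ (Fin p))
    (H : Matrix (Fin p) (Fin p) ℝ) : Prop where
  selfSimilar : ∀ c : ℝ, 0 < c → ∀ {J : Type} [Fintype J] (t : J → ℝ)
    (θ : J → EuclideanSpace ℝ (Fin p)), ∫ x, linComb (fun t => φ (c * t)) t θ x ^ 2 ∂ν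
      = ∫ x, linComb (fun t x => Matrix.toEuclideanLin (matPow c H) (φ t x)) t θ x ^ 2 ∂ν
  stationary : ∀ (h : ℝ) {J : Type} [Fintype J] (t : J → ℝ) (θ : J → EuclideanSpace ℝ (Fin p)),
    ∫ x, linComb (fun t x => φ (t + h) x - φ h x) t θ x ^ 2 ∂ν
      = ∫ x, linComb (fun t x => φ t x - φ 0 x) t θ x ^ 2 ∂ν

theorem HasFractionalCovariance.isOfBm [IsProbabilityMeasure Q]
    {H : Matrix (Fin p) (Fin p) ℝ} (hφ : HasFractionalCovariance ν φ H)
    (hB : HasCharFunctional Q B φ (gaussianCharFunctional ν)) (hH : ReEigIn H (Set.Ioc 0 1))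
    (hproper : IsProper Q B) : IsOfBm Q B H where
  hurst := hH
  gaussian := isGaussianProcess_of_map_linComb hB.aemeasurable fun _ θ =>
    ⟨_, hB.map_linComb_eq_gaussianReal _ θ⟩
  proper := hproper
  selfSimilar c hc := ((hB.comp_time (c * ·)).congr_charFunctional fun t θ => by
    simp only [gaussianCharFunctional, hφ.selfSimilar c hc]).fddEq (hB.map_linear _)
  stationaryIncrements h := ((hB.sub (· + h) fun _ => h).congr_charFunctional fun t θ => by
    simp only [gaussianCharFunctional, hφ.stationary h, id]).fddEq (hB.sub id fun _ => 0)

end PoissonGaussian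

section WhiteNoise

variable {ι S : Type*} [MeasurableSpace S] {m : Measure S}

theorem coeFn_sum_smul_Lp {q : ℝ≥0∞} (s : Finset ι) (a : ι → ℝ) (f : ι → Lp ℝ q m) :
    ((∑ i ∈ s, a i • f i : Lp ℝ q m) : S → ℝ) =ᵐ[m] fun x => ∑ i ∈ s, a i * f i x := by
  have hsmul : ∀ᵐ x ∂m, ∀ i ∈ s, (a i • f i : Lp ℝ q m) x = a i * f i x :=
    (Filter.eventually_all_finset s).2 fun i _ => Lp.coeFn_smul (a i) (f i)
  filter_upwards [Lp.coeFn_finsetSum s (fun i => a i • f i), hsmul] with x hsum hx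
  rw [hsum, Finset.sum_apply]
  exact Finset.sum_congr rfl hx

theorem continuous_integral_exp_mul_I_Lp [IsProbabilityMeasure m] :
    Continuous fun f : Lp ℝ 2 m => ∫ x, Complex.exp (f x * Complex.I) ∂m :=
  continuous_iff_continuousAt.2 fun f =>
    tendsto_integral_exp_mul_I (Lp.aestronglyMeasurable f) (fun g => Lp.aestronglyMeasurable g)
      ((Lp.tendsto_Lp_iff_tendsto_eLpNorm' _ f).1 tendsto_id)

/-- The law of a family of independent standard normal variables. -/
def stdNormalFamily (ι : Type*) : Measure (ι → ℝ) :=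
  Measure.infinitePi fun _ => gaussianReal 0 1

instance : IsProbabilityMeasure (stdNormalFamily ι) := by
  unfold stdNormalFamily; infer_instance

theorem measurePreserving_eval_stdNormalFamily (i : ι) :
    MeasurePreserving (Function.eval i) (stdNormalFamily ι) (gaussianReal 0 1) :=
  measurePreserving_eval_infinitePi (fun _ : ι => gaussianReal 0 1) i

theorem iIndepFun_eval_stdNormalFamily :
    iIndepFun (fun (i : ι) (ω : ι → ℝ) => ω i) (stdNormalFamily ι) :=
  iIndepFun_infinitePi (P := fun _ : ι => gaussianReal 0 1) (X := fun _ ω => ω)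
    fun _ => measurable_id

theorem memLp_eval_stdNormalFamily (i : ι) :
    MemLp (fun ω : ι → ℝ => ω i) 2 (stdNormalFamily ι) :=
  (memLp_id_gaussianReal 2).comp_measurePreserving (measurePreserving_eval_stdNormalFamily i)

/-- The `i`-th coordinate of a family of independent standard normal variables, in `L²`. -/
def stdNormalCoord (i : ι) : Lp ℝ 2 (stdNormalFamily ι) :=
  (memLp_eval_stdNormalFamily i).toLp

theorem integral_comp_eval_stdNormalFamily {F : Type*} [NormedAddCommGroup F] [NormedSpace ℝ F]
    {g : ℝ → F} (hg : Continuous g) (i : ι) :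
    ∫ ω, g (ω i) ∂(stdNormalFamily ι) = ∫ x, g x ∂(gaussianReal 0 1) := by
  rw [← (measurePreserving_eval_stdNormalFamily i).map_eq]
  exact (integral_map (measurable_pi_apply i).aemeasurable hg.aestronglyMeasurable).symm

theorem orthonormal_stdNormalCoord : Orthonormal ℝ (stdNormalCoord (ι := ι)) := by
  classical
  have hinner : ∀ i j : ι, inner ℝ (stdNormalCoord i) (stdNormalCoord j)
      = ∫ ω, ω i * ω j ∂(stdNormalFamily ι) := fun i j => by
    rw [L2.inner_def]
    refine integral_congr_ae ?_
    filter_upwards [(memLp_eval_stdNormalFamily i).coeFn_toLp,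
      (memLp_eval_stdNormalFamily j).coeFn_toLp] with ω hi hj
    simp [stdNormalCoord, hi, hj, mul_comm]
  rw [orthonormal_iff_ite]
  intro i j
  rw [hinner]
  split_ifs with hij
  · have hvar := variance_fun_id_gaussianReal (μ := 0) (v := 1)
    rw [variance_eq_integral measurable_id'.aemeasurable] at hvar
    simpa [hij, ← sq, integral_comp_eval_stdNormalFamily (continuous_pow 2)] using hvar
  · have hmul := (iIndepFun_eval_stdNormalFamily.indepFun hij).integral_mul_eq_mul_integral
      (measurable_pi_apply i).aestronglyMeasurable (measurable_pi_apply j).aestronglyMeasurable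
    have hmean : ∀ k : ι, ∫ ω, ω k ∂(stdNormalFamily ι) = 0 := fun k => by
      simpa using integral_comp_eval_stdNormalFamily (g := fun x => x) continuous_id k
    simpa [hmean] using hmul

theorem integral_exp_sum_stdNormalFamily (s : Finset ι) (c : ι → ℝ) :
    ∫ ω, Complex.exp ((∑ i ∈ s, c i * ω i : ℝ) * Complex.I) ∂(stdNormalFamily ι)
      = Complex.exp (-((∑ i ∈ s, c i ^ 2 : ℝ) : ℂ) / 2) := by
  have hindep := (iIndepFun_eval_stdNormalFamily (ι := ι)).precomp (g := ((↑) : s → ι))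
    Subtype.val_injective
  have hprod := hindep.integral_fun_prod_comp
    (f := fun (i : s) (x : ℝ) => Complex.exp (c i * x * Complex.I))
    (fun i => (measurable_pi_apply _).aemeasurable)
    (fun i => Measurable.aestronglyMeasurable (by fun_prop))
  have hcoord : ∀ i : ι, ∫ ω : ι → ℝ, Complex.exp (c i * ω i * Complex.I) ∂(stdNormalFamily ι)
      = Complex.exp (-(c i : ℂ) ^ 2 / 2) := fun i => by
    rw [integral_comp_eval_stdNormalFamily (g := fun x => Complex.exp (c i * x * Complex.I))
      (by fun_prop), ← charFun_apply_real, charFun_gaussianReal]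
    congr 1
    push_cast
    ring
  simp_rw [hcoord, ← Complex.exp_sum, ← Finset.sum_mul] at hprod
  simp_rw [Finset.sum_coe_sort s (fun i => -(c i : ℂ) ^ 2 / 2)] at hprod
  have hcast : ∀ ω : ι → ℝ, ((∑ i ∈ s, c i * ω i : ℝ) : ℂ) = ∑ i : s, (c i * ω i : ℂ) := fun ω => by
    rw [Finset.sum_coe_sort s (fun i => (c i * ω i : ℂ))]
    push_cast
    rfl
  simp_rw [hcast, hprod, Complex.ofReal_sum, Complex.ofReal_pow, ← Finset.sum_neg_distrib,
    Finset.sum_div]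

variable {E : Type*} [NormedAddCommGroup E] [InnerProductSpace ℝ E]

/-- The isonormal Gaussian process that maps a Hilbert basis to independent standard normal
variables. -/
def isonormal (b : HilbertBasis ι ℝ E) : E →ₗᵢ[ℝ] Lp ℝ 2 (stdNormalFamily ι) :=
  (orthonormal_stdNormalCoord (ι := ι)).orthogonalFamily.linearIsometry.comp
    b.repr.toLinearIsometry

theorem hasSum_isonormal (b : HilbertBasis ι ℝ E) (h : E) :
    HasSum (fun i => b.repr h i • stdNormalCoord i) (isonormal b h) :=
  (orthonormal_stdNormalCoord (ι := ι)).orthogonalFamily.hasSum_linearIsometry (b.repr h)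

theorem integral_exp_isonormal (b : HilbertBasis ι ℝ E) (h : E) :
    ∫ ω, Complex.exp (isonormal b h ω * Complex.I) ∂(stdNormalFamily ι)
      = Complex.exp (-((‖h‖ ^ 2 : ℝ) : ℂ) / 2) := by
  have hpartial : ∀ s : Finset ι, ∫ ω, Complex.exp
      ((∑ i ∈ s, b.repr h i • stdNormalCoord i : Lp ℝ 2 (stdNormalFamily ι)) ω * Complex.I)
        ∂(stdNormalFamily ι) = Complex.exp (-((∑ i ∈ s, b.repr h i ^ 2 : ℝ) : ℂ) / 2) := by
    intro s
    rw [← integral_exp_sum_stdNormalFamily]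
    refine integral_congr_ae ?_
    have hcoord : ∀ᵐ ω ∂(stdNormalFamily ι), ∀ i ∈ s, stdNormalCoord i ω = ω i :=
      (Filter.eventually_all_finset s).2 fun i _ => (memLp_eval_stdNormalFamily i).coeFn_toLp
    filter_upwards [coeFn_sum_smul_Lp s (b.repr h ·) stdNormalCoord, hcoord] with ω hsum hω
    rw [hsum, Finset.sum_congr rfl fun i hi => by rw [hω i hi]]
  have hnorm : HasSum (fun i => b.repr h i ^ 2) (‖h‖ ^ 2) := by
    simpa only [b.repr_apply_apply, real_inner_comm, sq, real_inner_self_eq_norm_sq] using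
      b.hasSum_inner_mul_inner h h
  have hcont : Continuous fun x : ℝ => Complex.exp (-(x : ℂ) / 2) := by fun_prop
  refine tendsto_nhds_unique
    ((continuous_integral_exp_mul_I_Lp.tendsto _).comp (hasSum_isonormal b h)) ?_
  exact ((hcont.tendsto _).comp hnorm).congr fun s => (hpartial s).symm

theorem exists_hasCharFunctional_gaussian {S : Type u} [MeasurableSpace S] (ν : Measure S) {p : ℕ}
    {φ : ℝ → S → EuclideanSpace ℝ (Fin p)} (hφ : ∀ t, MemLp (φ t) 2 ν) :
    ∃ (Ω : Type u) (_ : MeasurableSpace Ω) (P : Measure Ω) (_ : IsProbabilityMeasure P)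
      (B : ℝ → Ω → EuclideanSpace ℝ (Fin p)),
      HasCharFunctional P B φ (gaussianCharFunctional ν) := by
  obtain ⟨w, b, -⟩ := exists_hilbertBasis ℝ (Lp ℝ 2 ν)
  have hcoord : ∀ t k, MemLp (fun x => φ t x k) 2 ν := fun t k =>
    (EuclideanSpace.proj (𝕜 := ℝ) k : EuclideanSpace ℝ (Fin p) →L[ℝ] ℝ).comp_memLp' (hφ t)
  let W : ℝ → Fin p → Lp ℝ 2 (stdNormalFamily w) := fun t k => isonormal b (hcoord t k).toLp
  let B : ℝ → (w → ℝ) → EuclideanSpace ℝ (Fin p) := fun t ω => WithLp.toLp 2 fun k => W t k ω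
  refine ⟨w → ℝ, inferInstance, stdNormalFamily w, inferInstance, B, fun t => ?_, fun t θ => ?_⟩
  · exact (WithLp.measurable_toLp 2 _).comp_aemeasurable (aemeasurable_pi_lambda _ fun k =>
      (Lp.aestronglyMeasurable _).aemeasurable)
  let h : Lp ℝ 2 ν := ∑ jk : _ × Fin p, θ jk.1 jk.2 • (hcoord (t jk.1) jk.2).toLp
  have hφ_ae : h =ᵐ[ν] linComb φ t θ := by
    have hcoe : ∀ᵐ x ∂ν, ∀ j k, (hcoord (t j) k).toLp _ x = φ (t j) x k :=
      ae_all_iff.2 fun j => ae_all_iff.2 fun k => (hcoord (t j) k).coeFn_toLp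
    filter_upwards [coeFn_sum_smul_Lp Finset.univ (fun jk : _ × Fin p => θ jk.1 jk.2)
      (fun jk => (hcoord (t jk.1) jk.2).toLp), hcoe] with x hsum hx
    simp only [h]
    rw [hsum]
    simp [hx, linComb, PiLp.inner_apply, Fintype.sum_prod_type, mul_comm]
  have hB_ae : isonormal b h =ᵐ[stdNormalFamily w] linComb B t θ := by
    filter_upwards [coeFn_sum_smul_Lp Finset.univ (fun jk : _ × Fin p => θ jk.1 jk.2)
      (fun jk => W (t jk.1) jk.2)] with ω hsum
    simp only [h, map_sum, map_smul]
    rw [hsum]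
    simp [linComb, B, PiLp.inner_apply, Fintype.sum_prod_type, mul_comm]
  have hnorm : ‖h‖ ^ 2 = ∫ x, linComb φ t θ x ^ 2 ∂ν := by
    rw [← real_inner_self_eq_norm_sq, L2.inner_def]
    refine integral_congr_ae (hφ_ae.mono fun x hx => ?_)
    simp [hx, sq]
  rw [fddCharFun, gaussianCharFunctional, ← hnorm, ← integral_exp_isonormal b]
  exact integral_congr_ae (hB_ae.mono fun ω hω => by simp only [hω])

end WhiteNoise

section Dilation

/-- The unitary dilation `f ↦ r^{-1/2} f (x / r, z)` of `L²(ℝ × Z)` in the time variable. -/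
def dilate {Z E : Type*} [SMul ℝ E] (r : ℝ) (f : ℝ × Z → E) (x : ℝ × Z) : E :=
  (√r)⁻¹ • f (r⁻¹ * x.1, x.2)

theorem linComb_dilate {Z E J : Type*} [Fintype J] [NormedAddCommGroup E] [InnerProductSpace ℝ E]
    (r : ℝ) (φ : ℝ → ℝ × Z → E) (t : J → ℝ) (θ : J → E) :
    linComb (fun t => dilate r (φ t)) t θ = dilate r (linComb φ t θ) := by
  funext x
  simp [linComb, dilate, inner_smul_right, Finset.mul_sum]

variable {S Z E J : Type*} [MeasurableSpace S] [MeasurableSpace Z] [NormedAddCommGroup E]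
  {ν : Measure S} {μ : Measure Z} [SFinite μ] {r : ℝ} [Fintype J]

theorem map_prod_mul_left (hr : r ≠ 0) :
    ((volume : Measure ℝ).prod μ).map (Prod.map (r * ·) id)
      = ENNReal.ofReal |r⁻¹| • (volume : Measure ℝ).prod μ := by
  have _ : SFinite ((volume : Measure ℝ).map (r * ·)) := by
    rw [Real.map_volume_mul_left hr]
    infer_instance
  rw [← Measure.map_prod_map _ _ (measurable_const_mul r) measurable_id,
    Real.map_volume_mul_left hr, Measure.map_id, Measure.prod_smul_left]

theorem integral_prod_comp_inv_mul [NormedSpace ℝ E] (hr : 0 < r) (f : ℝ × Z → E) :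
    ∫ x, f (r⁻¹ * x.1, x.2) ∂(volume : Measure ℝ).prod μ
      = r • ∫ x, f x ∂(volume : Measure ℝ).prod μ := by
  have hemb : MeasurableEmbedding (Prod.map (r⁻¹ * ·) id : ℝ × Z → ℝ × Z) :=
    (measurableEmbedding_mulLeft₀ (inv_ne_zero hr.ne')).prodMap .id
  have hmap := hemb.integral_map (μ := (volume : Measure ℝ).prod μ) f
  rw [map_prod_mul_left (inv_ne_zero hr.ne'), integral_smul_measure, inv_inv, abs_of_pos hr,
    ENNReal.toReal_ofReal hr.le] at hmap
  exact hmap.symm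

theorem integral_dilate_sq (hr : 0 < r) (f : ℝ × Z → ℝ) :
    ∫ x, dilate r f x ^ 2 ∂(volume : Measure ℝ).prod μ
      = ∫ x, f x ^ 2 ∂(volume : Measure ℝ).prod μ := by
  simp only [dilate, smul_eq_mul, mul_pow, integral_const_mul, inv_pow, Real.sq_sqrt hr.le]
  rw [integral_prod_comp_inv_mul hr (fun x => f x ^ 2), smul_eq_mul, inv_mul_cancel_left₀ hr.ne']

theorem integral_compExp_dilate (hr : 0 < r) (f : ℝ × Z → ℝ) :
    ∫ x, compExp (dilate r f x) ∂(volume : Measure ℝ).prod μ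
      = r * ∫ x, compExp ((√r)⁻¹ * f x) ∂(volume : Measure ℝ).prod μ := by
  simp only [dilate, smul_eq_mul]
  rw [integral_prod_comp_inv_mul hr fun x => compExp ((√r)⁻¹ * f x), Complex.real_smul]

theorem linComb_congr_ae [InnerProductSpace ℝ E] {φ ψ : ℝ → S → E}
    (h : ∀ t, φ t =ᵐ[ν] ψ t) (t : J → ℝ) (θ : J → E) : linComb φ t θ =ᵐ[ν] linComb ψ t θ := by
  filter_upwards [eventually_all.2 fun j => h (t j)] with x hx
  simp only [linComb, hx]

theorem integral_linComb_sq_congr_dilate [InnerProductSpace ℝ E] {φ ψ : ℝ → ℝ × Z → E}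
    (hr : 0 < r) (h : ∀ t, ψ t =ᵐ[(volume : Measure ℝ).prod μ] dilate r (φ t)) (t : J → ℝ)
    (θ : J → E) : ∫ x, linComb ψ t θ x ^ 2 ∂(volume : Measure ℝ).prod μ
      = ∫ x, linComb φ t θ x ^ 2 ∂(volume : Measure ℝ).prod μ := by
  rw [← integral_dilate_sq hr (linComb φ t θ), ← linComb_dilate]
  exact integral_congr_ae ((linComb_congr_ae h t θ).fun_comp (· ^ 2))

end Dilation

section CentralLimit

theorem norm_mul_compExp_le {r : ℝ} (hr : 0 < r) (u : ℝ) :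
    ‖r * compExp ((√r)⁻¹ * u)‖ ≤ u ^ 2 := by
  calc ‖r * compExp ((√r)⁻¹ * u)‖ ≤ r * ((√r)⁻¹ * u) ^ 2 := by
        rw [norm_mul, Complex.norm_of_nonneg hr.le]
        gcongr
        exact norm_compExp_le _
    _ = u ^ 2 := by rw [mul_pow, inv_pow, Real.sq_sqrt hr.le, mul_inv_cancel_left₀ hr.ne']

theorem norm_mul_compExp_add_sq_div_two_le {r : ℝ} (hr : 0 < r) (u : ℝ) :
    ‖r * compExp ((√r)⁻¹ * u) + (u : ℂ) ^ 2 / 2‖ ≤ (√r)⁻¹ * |u| ^ 3 := by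
  have hsq : r * (√r)⁻¹ ^ 2 = 1 := by
    rw [inv_pow, Real.sq_sqrt hr.le, mul_inv_cancel₀ hr.ne']
  have hfactor : (r : ℂ) * compExp ((√r)⁻¹ * u) + (u : ℂ) ^ 2 / 2
      = r * (compExp ((√r)⁻¹ * u) + (((√r)⁻¹ * u : ℝ) : ℂ) ^ 2 / 2) := by
    have hsqC : (r : ℂ) * ((√r)⁻¹ : ℝ) ^ 2 = 1 := mod_cast hsq
    rw [Complex.ofReal_mul]
    linear_combination -(u : ℂ) ^ 2 / 2 * hsqC
  calc ‖r * compExp ((√r)⁻¹ * u) + (u : ℂ) ^ 2 / 2‖ ≤ r * |(√r)⁻¹ * u| ^ 3 := by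
        rw [hfactor, norm_mul, Complex.norm_of_nonneg hr.le]
        gcongr
        exact norm_compExp_add_sq_div_two_le _
    _ = (√r)⁻¹ * |u| ^ 3 := by
        rw [abs_mul, abs_of_nonneg (by positivity : 0 ≤ (√r)⁻¹)]
        linear_combination (√r)⁻¹ * |u| ^ 3 * hsq

theorem tendsto_mul_integral_compExp {S ι : Type*} [MeasurableSpace S] {ν : Measure S}
    {l : Filter ι} [l.IsCountablyGenerated] {r : ι → ℝ} (hr : Tendsto r l atTop) {f : ι → S → ℝ}
    {V : S → ℝ} {q : ℝ} (hf : ∀ c, AEStronglyMeasurable (f c) ν) (hV : MemLp V 2 ν)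
    (hfV : ∀ c x, |f c x| ≤ V x) (hq : ∀ c, ∫ x, f c x ^ 2 ∂ν = q) :
    Tendsto (fun c => r c * ∫ x, compExp ((√(r c))⁻¹ * f c x) ∂ν) l (𝓝 (-(q : ℂ) / 2)) := by
  have hpos : ∀ᶠ c in l, 0 < r c := hr.eventually_gt_atTop 0
  have hfL : ∀ c, MemLp (f c) 2 ν := fun c => hV.mono' (hf c) (ae_of_all _ (hfV c))
  have hremainder : Tendsto
      (fun c => ∫ x, (r c * compExp ((√(r c))⁻¹ * f c x) + (f c x : ℂ) ^ 2 / 2) ∂ν) l (𝓝 0) := by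
    rw [← integral_zero S ℂ (μ := ν)]
    refine tendsto_integral_filter_of_dominated_convergence (fun x => 2 * V x ^ 2)
      (Eventually.of_forall fun c => ?_) ?_ (hV.integrable_sq.const_mul 2) (ae_of_all _ fun x => ?_)
    · exact (by fun_prop : Continuous fun u : ℝ => r c * compExp ((√(r c))⁻¹ * u)
        + (u : ℂ) ^ 2 / 2).comp_aestronglyMeasurable (hf c)
    · filter_upwards [hpos] with c hc
      refine ae_of_all _ fun x => (norm_add_le _ _).trans ?_
      have hfx : f c x ^ 2 ≤ V x ^ 2 := sq_le_sq' (abs_le.1 (hfV c x)).1 (abs_le.1 (hfV c x)).2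
      have hquad : ‖(f c x : ℂ) ^ 2 / 2‖ = f c x ^ 2 / 2 := by simp
      rw [hquad]
      linarith [norm_mul_compExp_le hc (f c x), sq_nonneg (f c x)]
    · have hV3 : Tendsto (fun c => (√(r c))⁻¹ * V x ^ 3) l (𝓝 0) := by
        simpa using (tendsto_inv_atTop_zero.comp (Real.tendsto_sqrt_atTop.comp hr)).mul_const
          (V x ^ 3)
      refine squeeze_zero_norm' (hpos.mono fun c hc => ?_) hV3
      refine (norm_mul_compExp_add_sq_div_two_le hc _).trans ?_
      gcongr
      exact hfV c x
  have hlim := hremainder.sub_const ((q : ℂ) / 2)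
  rw [zero_sub, ← neg_div] at hlim
  refine hlim.congr fun c => ?_
  have hcomp : Integrable (fun x => (r c : ℂ) * compExp ((√(r c))⁻¹ * f c x)) ν :=
    (integrable_compExp_comp ((hfL c).const_mul _)).const_mul _
  have hsquare : Integrable (fun x => (f c x : ℂ) ^ 2 / 2) ν := by
    simpa using ((hfL c).integrable_sq.ofReal (𝕜 := ℂ)).div_const 2
  have hqc : ∫ x, (f c x : ℂ) ^ 2 / 2 ∂ν = (q : ℂ) / 2 := by
    rw [integral_div, ← hq c, ← integral_complex_ofReal]
    simp
  rw [integral_add hcomp hsquare, hqc, add_sub_cancel_right, integral_const_mul]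

variable {Ω Ω' S Z : Type*} [MeasurableSpace Ω] [MeasurableSpace Ω'] [MeasurableSpace S]
  [MeasurableSpace Z] {p : ℕ} {P : Measure Ω} {Q : Measure Ω'} {ν : Measure S} {μ : Measure Z}

theorem HasCharFunctional.congr_ae {X : ℝ → Ω → EuclideanSpace ℝ (Fin p)}
    {φ ψ : ℝ → S → EuclideanSpace ℝ (Fin p)}
    (hX : HasCharFunctional P X φ (poissonCharFunctional ν)) (h : ∀ t, φ t =ᵐ[ν] ψ t) :
    HasCharFunctional P X ψ (poissonCharFunctional ν) :=
  hX.congr_charFunctional fun t θ => poissonCharFunctional_congr_ae (linComb_congr_ae h t θ)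

theorem fddTendsto_of_hasCharFunctional_dilate [SFinite μ] [IsProbabilityMeasure P]
    [IsProbabilityMeasure Q] {l : Filter ℝ} [l.IsCountablyGenerated]
    {X : ℝ → ℝ → Ω → EuclideanSpace ℝ (Fin p)} {B : ℝ → Ω' → EuclideanSpace ℝ (Fin p)}
    {φ : ℝ → ℝ × Z → EuclideanSpace ℝ (Fin p)} {ψ : ℝ → ℝ → ℝ × Z → EuclideanSpace ℝ (Fin p)}
    {r : ℝ → ℝ} {v : ℝ → ℝ × Z → ℝ} (hX : ∀ c t, AEMeasurable (X c t) P)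
    (hXψ : ∀ᶠ c in l, HasCharFunctional P (X c) (fun t => dilate (r c) (ψ c t))
      (poissonCharFunctional ((volume : Measure ℝ).prod μ)))
    (hr : Tendsto r l atTop)
    (hψ : ∀ c t, AEStronglyMeasurable (ψ c t) ((volume : Measure ℝ).prod μ))
    (hv : ∀ t, MemLp (v t) 2 ((volume : Measure ℝ).prod μ)) (hψv : ∀ c t x, ‖ψ c t x‖ ≤ v t x)
    (hcov : ∀ (c : ℝ) {J : Type} [Fintype J] (t : J → ℝ) (θ : J → EuclideanSpace ℝ (Fin p)),
      ∫ x, linComb (ψ c) t θ x ^ 2 ∂(volume : Measure ℝ).prod μ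
        = ∫ x, linComb φ t θ x ^ 2 ∂(volume : Measure ℝ).prod μ)
    (hB : HasCharFunctional Q B φ (gaussianCharFunctional ((volume : Measure ℝ).prod μ))) :
    FddTendsto P X l Q B := by
  refine fddTendsto_of_tendsto_fddCharFun hX hB.aemeasurable fun I θ => ?_
  rw [hB.fddCharFun_eq, gaussianCharFunctional]
  have hexponent := tendsto_mul_integral_compExp hr
    (f := fun c => linComb (ψ c) (fun i : I => (i : ℝ)) θ) (V := fun x => ∑ i, ‖θ i‖ * v i x)
    (fun c => Finset.aestronglyMeasurable_fun_sum _ fun i _ => (hψ c i).const_inner)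
    (memLp_finsetSum _ fun i _ => (hv i).const_mul _)
    (fun c x => (Finset.abs_sum_le_sum_abs _ _).trans <| Finset.sum_le_sum fun i _ =>
      (abs_real_inner_le_norm _ _).trans <| by gcongr; exact hψv c i x)
    (fun c => hcov c _ θ)
  refine ((Complex.continuous_exp.tendsto _).comp hexponent).congr' ?_
  filter_upwards [hXψ, hr.eventually_gt_atTop 0] with c hc hrc
  rw [hc.fddCharFun_eq, poissonCharFunctional, linComb_dilate, integral_compExp_dilate hrc,
    Function.comp_apply]

theorem exists_isOfBm_hasCharFunctional [IsProbabilityMeasure P] {S : Type} [MeasurableSpace S]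
    {ν : Measure S} {X : ℝ → Ω → EuclideanSpace ℝ (Fin p)}
    {φ : ℝ → S → EuclideanSpace ℝ (Fin p)} {H : Matrix (Fin p) (Fin p) ℝ}
    (hX : HasCharFunctional P X φ (poissonCharFunctional ν)) (hproper : IsProper P X)
    (hφL : ∀ t, MemLp (φ t) 2 ν) (hφ : HasFractionalCovariance ν φ H)
    (hH : ReEigIn H (Set.Ioc 0 1)) :
    ∃ (Ω' : Type) (_ : MeasurableSpace Ω') (Q : Measure Ω') (_ : IsProbabilityMeasure Q)
      (B : ℝ → Ω' → EuclideanSpace ℝ (Fin p)),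
      IsOfBm Q B H ∧ HasCharFunctional Q B φ (gaussianCharFunctional ν) := by
  obtain ⟨Ω', _, Q, _, B, hB⟩ := exists_hasCharFunctional_gaussian ν hφL
  exact ⟨Ω', _, Q, ‹_›, B, hφ.isOfBm hB hH (hproper.gaussian_of_poisson hφL hX hB), hB⟩

end CentralLimit

section Fourier

open scoped SchwartzMap

variable {f f' F F' : ℝ → ℂ} {c : ℝ}

theorem exists_schwartz_fourier_eq_comp_mul (u : 𝓢(ℝ, ℂ)) (hc : 0 < c) :
    ∃ v : 𝓢(ℝ, ℂ), (∀ ξ, v ξ = u (c⁻¹ * ξ)) ∧ ∀ s : ℝ, (𝓕 v) s = (c : ℂ) * (𝓕 u) (c * s) := by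
  let e : ℝ ≃L[ℝ] ℝ := ContinuousLinearEquiv.unitsEquivAut ℝ (Units.mk0 c⁻¹ (inv_ne_zero hc.ne'))
  let v := SchwartzMap.compCLMOfContinuousLinearEquiv ℂ e u
  have hv : ∀ ξ, v ξ = u (c⁻¹ * ξ) := fun ξ => by simp [v, e, mul_comm]
  refine ⟨v, hv, fun s => ?_⟩
  have hsubst := Measure.integral_comp_inv_mul_left (fun y : ℝ =>
    Complex.exp (↑(-2 * Real.pi * inner ℝ y (c * s)) * Complex.I) • u y) c
  rw [SchwartzMap.fourier_coe, SchwartzMap.fourier_coe, Real.fourier_eq', Real.fourier_eq',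
    ← Complex.real_smul]
  rw [abs_of_pos hc] at hsubst
  rw [← hsubst]
  refine integral_congr_ae (ae_of_all _ fun x => ?_)
  have hinner : inner ℝ (c⁻¹ * x) (c * s) = inner ℝ x s := by
    simp only [RCLike.inner_apply, map_mul, conj_trivial]
    field_simp
  simp only [hv, hinner]

theorem exists_schwartz_fourier_eq_comp_add (u : 𝓢(ℝ, ℂ)) (h : ℝ) :
    ∃ v : 𝓢(ℝ, ℂ), (∀ ξ : ℝ, v ξ = Complex.exp (Complex.I * h * ↑(-(2 * Real.pi * ξ))) * u ξ) ∧
      ∀ s : ℝ, (𝓕 v) s = (𝓕 u) (s + h) := by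
  let w : 𝓢(ℝ, ℂ) := SchwartzMap.compSubConstCLM ℂ (-h) (𝓕 u)
  have hw : ∀ s, w s = (𝓕 u) (s + h) := fun s => by simp [w]
  refine ⟨𝓕⁻ w, fun ξ => ?_, fun s => by rw [FourierTransform.fourier_fourierInv_eq, hw]⟩
  have hshift := congrFun (VectorFourier.fourierIntegral_comp_add_right Real.fourierChar volume
    (innerₗ ℝ) (⇑(𝓕 u : 𝓢(ℝ, ℂ))) h) (-ξ)
  have hwcomp : ⇑w = ⇑(𝓕 u : 𝓢(ℝ, ℂ)) ∘ fun s => s + h := funext hw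
  rw [SchwartzMap.fourierInv_coe, Real.fourierInv_eq_fourier_neg, hwcomp]
  refine hshift.trans ?_
  have hinv : VectorFourier.fourierIntegral Real.fourierChar volume (innerₗ ℝ)
      (⇑(𝓕 u : 𝓢(ℝ, ℂ))) (-ξ) = u ξ := by
    have happly : (𝓕⁻ (𝓕 u : 𝓢(ℝ, ℂ)) : 𝓢(ℝ, ℂ)) ξ = u ξ := by
      rw [FourierTransform.fourierInv_fourier_eq]
    rw [SchwartzMap.fourierInv_coe, Real.fourierInv_eq_fourier_neg] at happly
    exact happly
  rw [hinv, Circle.smul_def, smul_eq_mul, Real.fourierChar_apply]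
  congr 2
  simp
  ring

theorem fourier_toLp_eq_iff (hf : MemLp f 2 volume) (hF : MemLp F 2 volume) :
    𝓕 (hf.toLp f) = hF.toLp F ↔ ∀ u : 𝓢(ℝ, ℂ), ∫ x, (𝓕 u) x * f x = ∫ x, u x * F x := by
  have hcoe : ∀ {G : ℝ → ℂ} (hG : MemLp G 2 volume) (u : 𝓢(ℝ, ℂ)),
      Lp.toTemperedDistribution (hG.toLp G) u = ∫ x, u x * G x := fun hG u => by
    rw [Lp.toTemperedDistribution_apply]
    exact integral_congr_ae (hG.coeFn_toLp.mono fun x hx => by simp only [hx, smul_eq_mul])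
  have hinj := LinearMap.ker_eq_bot.1
    (Lp.ker_toTemperedDistributionCLM_eq_bot (F := ℂ) (μ := (volume : Measure ℝ)) (p := 2))
  rw [← hinj.eq_iff]
  change Lp.toTemperedDistribution _ = Lp.toTemperedDistribution _ ↔ _
  rw [← Lp.fourier_toTemperedDistribution_eq]
  simp only [DFunLike.ext_iff, TemperedDistribution.fourier_apply, hcoe]

theorem memLp_comp_mul_left (hf : MemLp f 2 volume) (hc : c ≠ 0) :
    MemLp (fun x => f (c * x)) 2 volume := by
  refine MemLp.comp_of_map (f := (c * ·)) ?_ (by fun_prop)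
  rw [Real.map_volume_mul_left hc]
  exact hf.smul_measure ENNReal.ofReal_ne_top

namespace IsL2Fourier

theorem comp_inv_mul (h : IsL2Fourier f F) (hc : 0 < c) :
    IsL2Fourier (fun s => f (c⁻¹ * s)) (fun x => c * F (c * x)) := by
  obtain ⟨hf, hF, hfF⟩ := h
  have hneg : ∀ ξ : ℝ, c * -(2 * Real.pi * ξ) = -(2 * Real.pi * (c * ξ)) := fun ξ => by ring
  refine ⟨memLp_comp_mul_left hf (inv_ne_zero hc.ne'), ?_, (fourier_toLp_eq_iff _ _).2 fun u => ?_⟩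
  · simp only [hneg]
    exact (memLp_comp_mul_left hF hc.ne').const_mul (c : ℂ)
  obtain ⟨v, hv, hvF⟩ := exists_schwartz_fourier_eq_comp_mul u hc
  have hleft := Measure.integral_comp_inv_mul_left (fun s => (𝓕 u) (c * s) * f s) c
  have hright := Measure.integral_comp_inv_mul_left
    (fun ξ => u ξ * F (-(2 * Real.pi * (c * ξ)))) c
  simp only [mul_inv_cancel_left₀ hc.ne', abs_of_pos hc, ← hv] at hleft hright
  calc ∫ s, (𝓕 u) s * f (c⁻¹ * s) = ∫ s, (𝓕 v) s * f s := by
        rw [hleft, ← integral_smul]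
        simp only [hvF, Complex.real_smul, mul_assoc]
    _ = ∫ ξ, v ξ * F (-(2 * Real.pi * ξ)) := (fourier_toLp_eq_iff hf hF).1 hfF v
    _ = ∫ ξ, u ξ * (c * F (c * -(2 * Real.pi * ξ))) := by
        rw [hright, ← integral_smul]
        simp only [hneg, Complex.real_smul, mul_left_comm]

theorem comp_sub (hfF : IsL2Fourier f F) (h : ℝ) :
    IsL2Fourier (fun s => f (s - h)) (fun x => Complex.exp (Complex.I * h * x) * F x) := by
  obtain ⟨hf, hF, hfF⟩ := hfF
  have hphase : ∀ x : ℝ, ‖Complex.exp (Complex.I * h * x)‖ = 1 := fun x => by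
    rw [mul_assoc, ← Complex.ofReal_mul, Complex.norm_exp_I_mul_ofReal]
  refine ⟨hf.comp_measurePreserving (measurePreserving_sub_right volume h), ?_,
    (fourier_toLp_eq_iff _ _).2 fun u => ?_⟩
  · refine hF.of_le (.mul (Continuous.aestronglyMeasurable (by fun_prop)) hF.1)
      (ae_of_all _ fun ξ => by rw [norm_mul, hphase, one_mul])
  obtain ⟨v, hv, hvF⟩ := exists_schwartz_fourier_eq_comp_add u h
  calc ∫ s, (𝓕 u) s * f (s - h) = ∫ s, (𝓕 v) s * f s := by
        rw [← integral_add_right_eq_self (fun s => (𝓕 u : 𝓢(ℝ, ℂ)) s * f (s - h)) h]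
        simp only [hvF, add_sub_cancel_right]
    _ = ∫ ξ, v ξ * F (-(2 * Real.pi * ξ)) := (fourier_toLp_eq_iff hf hF).1 hfF v
    _ = ∫ ξ, u ξ * (Complex.exp (Complex.I * h * ↑(-(2 * Real.pi * ξ)))
        * F (-(2 * Real.pi * ξ))) := by
        simp only [hv, mul_assoc, mul_left_comm]

theorem ae_eq (h : IsL2Fourier f F) (h' : IsL2Fourier f' F) : f =ᵐ[volume] f' := by
  obtain ⟨hf, hF, hfF⟩ := h
  obtain ⟨hf', hF', hfF'⟩ := h'
  exact (MemLp.toLp_eq_toLp_iff hf hf').1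
    ((Lp.fourierTransformₗᵢ ℝ ℂ).injective (hfF.trans hfF'.symm))

theorem zero : IsL2Fourier (fun _ => 0) fun _ => 0 :=
  ⟨MemLp.zero', MemLp.zero', (fourier_toLp_eq_iff _ _).2 fun _ => by simp⟩

theorem add (h : IsL2Fourier f F) (h' : IsL2Fourier f' F') :
    IsL2Fourier (fun s => f s + f' s) (fun x => F x + F' x) := by
  obtain ⟨hf, hF, hfF⟩ := h
  obtain ⟨hf', hF', hfF'⟩ := h'
  refine ⟨hf.add hf', hF.add hF', ?_⟩
  have hsum := congrArg₂ (· + ·) hfF hfF'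
  rwa [← FourierTransform.fourier_add] at hsum

theorem const_mul (h : IsL2Fourier f F) (a : ℂ) :
    IsL2Fourier (fun s => a * f s) (fun x => a * F x) := by
  obtain ⟨hf, hF, hfF⟩ := h
  refine ⟨hf.const_mul a, hF.const_mul a, ?_⟩
  have hsmul := congrArg (a • ·) hfF
  rwa [← FourierTransform.fourier_smul] at hsmul

theorem sum {ι : Type*} (s : Finset ι) {f F : ι → ℝ → ℂ} (h : ∀ i, IsL2Fourier (f i) (F i)) :
    IsL2Fourier (fun x => ∑ i ∈ s, f i x) (fun x => ∑ i ∈ s, F i x) := by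
  classical
  induction s using Finset.induction_on with
  | empty => simpa using zero
  | insert i s hi ih =>
    simp only [Finset.sum_insert hi]
    exact (h i).add ih

end IsL2Fourier

end Fourier

section MatPow

variable {p : ℕ} {c : ℝ}

theorem matPow_add {M M' : Matrix (Fin p) (Fin p) ℝ} (h : Commute M M') :
    matPow c (M + M') = matPow c M * matPow c M' := by
  unfold matPow
  rw [smul_add, Matrix.exp_add_of_commute _ _ ((h.smul_left _).smul_right _)]

theorem matPow_mul {x : ℝ} (hc : c ≠ 0) (hx : x ≠ 0) (M : Matrix (Fin p) (Fin p) ℝ) :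
    matPow (c * x) M = matPow c M * matPow x M := by
  unfold matPow
  rw [Real.log_mul hc hx, add_smul,
    Matrix.exp_add_of_commute _ _ (((Commute.refl M).smul_left _).smul_right _)]

theorem matPow_smul_one (hc : 0 < c) (r : ℝ) :
    matPow c (r • (1 : Matrix (Fin p) (Fin p) ℝ)) = c ^ r • (1 : Matrix (Fin p) (Fin p) ℝ) := by
  unfold matPow
  rw [smul_smul, ← Matrix.diagonal_one, ← Matrix.diagonal_smul, Matrix.exp_diagonal,
    ← Matrix.diagonal_smul]
  congr 1
  funext i
  rw [Pi.coe_exp]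
  simp [Real.rpow_def_of_pos hc, ← Real.exp_eq_exp_ℝ]

theorem matPow_neg_mul_matPow (c : ℝ) (M : Matrix (Fin p) (Fin p) ℝ) :
    matPow c (-M) * matPow c M = 1 := by
  rw [← matPow_add (Commute.refl M).neg_left, neg_add_cancel, matPow, smul_zero,
    NormedSpace.exp_zero]

theorem toEuclideanLin_matPow_neg_matPow (c : ℝ) (M : Matrix (Fin p) (Fin p) ℝ)
    (x : EuclideanSpace ℝ (Fin p)) :
    Matrix.toEuclideanLin (matPow c (-M)) (Matrix.toEuclideanLin (matPow c M) x) = x := by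
  simp [Matrix.toLpLin_apply, matPow_neg_mul_matPow]

theorem matPow_mul_matPow_neg_sub_half (hc : 0 < c) (M : Matrix (Fin p) (Fin p) ℝ) :
    matPow c M * matPow c (-(M - (1 / 2 : ℝ) • 1)) = √c • (1 : Matrix (Fin p) (Fin p) ℝ) := by
  have hcomm : Commute M (-(M - (1 / 2 : ℝ) • 1)) :=
    ((Commute.refl M).sub_right ((Commute.one_right M).smul_right _)).neg_right
  rw [← matPow_add hcomm, neg_sub, add_sub_cancel, matPow_smul_one hc, Real.sqrt_eq_rpow]

theorem measurable_matPow (M : Matrix (Fin p) (Fin p) ℝ) (i k : Fin p) :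
    Measurable fun x : ℝ => matPow x M i k := by
  let _ : NormedRing (Matrix (Fin p) (Fin p) ℝ) := Matrix.linftyOpNormedRing
  let _ : NormedAlgebra ℝ (Matrix (Fin p) (Fin p) ℝ) := Matrix.linftyOpNormedAlgebra
  let _ : NormedAlgebra ℚ (Matrix (Fin p) (Fin p) ℝ) := NormedAlgebra.restrictScalars ℚ ℝ _
  have hexp : Continuous fun u : ℝ => NormedSpace.exp (u • M) :=
    NormedSpace.exp_continuous.comp (continuous_id.smul continuous_const)
  exact (hexp.matrix_elem i k).measurable.comp Real.measurable_log

theorem toComplex_mul (M M' : Matrix (Fin p) (Fin p) ℝ) :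
    toComplex (M * M') = toComplex M * toComplex M' :=
  Matrix.map_mul (f := Complex.ofRealHom)

theorem toComplex_map_conj (M : Matrix (Fin p) (Fin p) ℝ) :
    (toComplex M).map (starRingEnd ℂ) = toComplex M := by
  ext i k
  simp [toComplex]

end MatPow

section HarmKernel

variable {p : ℕ} (H : Matrix (Fin p) (Fin p) ℝ) (A : Matrix (Fin p) (Fin p) ℂ) {c : ℝ}

/-- The factor `x₊^{-D} A + x₋^{-D} conj A` of the Fourier domain kernel, with
`D = H - (1/2) I`. -/
def spectralFactor (x : ℝ) : Matrix (Fin p) (Fin p) ℂ :=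
  if 0 < x then toComplex (matPow x (-(H - (1 / 2 : ℝ) • 1))) * A
  else if x < 0 then toComplex (matPow (-x) (-(H - (1 / 2 : ℝ) • 1))) * A.map (starRingEnd ℂ)
  else 0

theorem harmKernel_eq_smul_spectralFactor (t x : ℝ) : harmKernel H A t x =
    ((Complex.exp (Complex.I * t * x) - 1) / (Complex.I * x)) • spectralFactor H A x := rfl

theorem toComplex_matPow_mul_spectralFactor (hc : 0 < c) (x : ℝ) :
    toComplex (matPow c H) * spectralFactor H A (c * x) = (√c : ℂ) • spectralFactor H A x := by
  have hpow : ∀ y : ℝ, y ≠ 0 → ∀ B : Matrix (Fin p) (Fin p) ℂ,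
      toComplex (matPow c H) * (toComplex (matPow (c * y) (-(H - (1 / 2 : ℝ) • 1))) * B)
        = (√c : ℂ) • (toComplex (matPow y (-(H - (1 / 2 : ℝ) • 1))) * B) := fun y hy B => by
    have hsmul : ∀ M : Matrix (Fin p) (Fin p) ℝ, toComplex (√c • M) = (√c : ℂ) • toComplex M :=
      fun M => by ext; simp [toComplex]
    rw [← Matrix.mul_assoc, ← toComplex_mul, matPow_mul hc.ne' hy, ← Matrix.mul_assoc,
      matPow_mul_matPow_neg_sub_half hc, smul_mul_assoc, one_mul, hsmul, smul_mul_assoc]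
  have hneg : c * x < 0 ↔ x < 0 := by simp [mul_neg_iff, hc, hc.not_gt]
  simp only [spectralFactor, mul_pos_iff_of_pos_left hc, hneg]
  split_ifs with hx hx'
  · exact hpow x hx.ne' A
  · rw [← mul_neg, hpow (-x) (neg_ne_zero.2 hx'.ne)]
  · simp

theorem spectralFactor_neg (x : ℝ) :
    spectralFactor H A (-x) = (spectralFactor H A x).map (starRingEnd ℂ) := by
  have hconj : (A.map (starRingEnd ℂ)).map (starRingEnd ℂ) = A := by ext; simp
  rcases lt_trichotomy x 0 with hx | rfl | hx
  · simp [spectralFactor, hx, hx.not_gt, toComplex_map_conj, hconj]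
  · simp [spectralFactor]
  · simp [spectralFactor, hx, hx.not_gt, toComplex_map_conj]

theorem measurable_spectralFactor (i k : Fin p) : Measurable fun x => spectralFactor H A x i k := by
  have hmul : ∀ (M : Matrix (Fin p) (Fin p) ℝ) (B : Matrix (Fin p) (Fin p) ℂ),
      Measurable fun x : ℝ => (toComplex (matPow x M) * B) i k := fun M B => by
    simp only [Matrix.mul_apply, toComplex, Matrix.map_apply]
    exact Finset.measurable_sum _ fun l _ =>
      (Complex.measurable_ofReal.comp (measurable_matPow M i l)).mul_const _
  simp only [spectralFactor, apply_ite (fun M : Matrix (Fin p) (Fin p) ℂ => M i k)]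
  exact Measurable.ite measurableSet_Ioi (hmul _ _)
    (Measurable.ite measurableSet_Iio ((hmul _ _).comp measurable_neg) measurable_const)

theorem measurable_harmKernel (t : ℝ) (i k : Fin p) :
    Measurable fun x => harmKernel H A t x i k := by
  simp only [harmKernel_eq_smul_spectralFactor, Matrix.smul_apply, smul_eq_mul]
  exact Measurable.mul (by fun_prop) (measurable_spectralFactor H A i k)

theorem harmKernel_zero (x : ℝ) : harmKernel H A 0 x = 0 := by
  simp [harmKernel_eq_smul_spectralFactor]

theorem harmKernel_add (t h x : ℝ) : harmKernel H A (t + h) x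
    = harmKernel H A h x + Complex.exp (Complex.I * h * x) • harmKernel H A t x := by
  have hexp : Complex.exp (Complex.I * ↑(t + h) * x)
      = Complex.exp (Complex.I * h * x) * Complex.exp (Complex.I * t * x) := by
    rw [← Complex.exp_add]
    push_cast
    ring_nf
  simp only [harmKernel_eq_smul_spectralFactor, smul_smul, ← add_smul, hexp]
  ring_nf

theorem harmKernel_neg (t x : ℝ) :
    harmKernel H A t (-x) = (harmKernel H A t x).map (starRingEnd ℂ) := by
  ext i k
  simp [harmKernel_eq_smul_spectralFactor, spectralFactor_neg, ← Complex.exp_conj]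

theorem harmKernel_mul (hc : 0 < c) (t x : ℝ) : harmKernel H A (c * t) x
    = (√c : ℂ) • (toComplex (matPow c H) * harmKernel H A t (c * x)) := by
  have hsqrt : (√c : ℂ) * √c = c := by rw [← Complex.ofReal_mul, Real.mul_self_sqrt hc.le]
  have hcC : (c : ℂ) ≠ 0 := Complex.ofReal_ne_zero.2 hc.ne'
  simp only [harmKernel_eq_smul_spectralFactor, mul_smul_comm,
    toComplex_matPow_mul_spectralFactor H A hc, smul_smul]
  congr 1
  push_cast
  rw [mul_left_comm Complex.I (c : ℂ) (x : ℂ), mul_left_comm (√c : ℂ), hsqrt,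
    mul_comm _ (c : ℂ), ← mul_div_assoc, mul_div_mul_left _ _ hcC]
  ring_nf

/-- The Fourier domain kernel `e^{ihx} g̃_t(x)` of the increments `t ↦ X (t + h) - X h`. -/
def incrementKernel (h t x : ℝ) : Matrix (Fin p) (Fin p) ℂ :=
  Complex.exp (Complex.I * h * x) • harmKernel H A t x

theorem incrementKernel_zero : incrementKernel H A 0 = harmKernel H A := by
  funext t x
  simp [incrementKernel]

theorem incrementKernel_mul (hc : 0 < c) (h t x : ℝ) : incrementKernel H A (c * h) (c * t) x
    = (√c : ℂ) • (toComplex (matPow c H) * incrementKernel H A h t (c * x)) := by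
  simp only [incrementKernel, harmKernel_mul H A hc, mul_smul_comm]
  rw [smul_comm]
  push_cast
  ring_nf

theorem measurable_incrementKernel (h t : ℝ) (i k : Fin p) :
    Measurable fun x => incrementKernel H A h t x i k := by
  simp only [incrementKernel, Matrix.smul_apply, smul_eq_mul]
  exact Measurable.mul (by fun_prop) (measurable_harmKernel H A t i k)

theorem norm_exp_I_mul_mul (h x : ℝ) : ‖Complex.exp (Complex.I * h * x)‖ = 1 := by
  rw [mul_assoc, ← Complex.ofReal_mul, Complex.norm_exp_I_mul_ofReal]

end HarmKernel

section LevyMeasure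

variable {E : Type*} [NormedAddCommGroup E] [MeasurableSpace E] [BorelSpace E]
  [SecondCountableTopology E] {μ : Measure E}

theorem IsLevyMeasure₂.memLp_id (h : IsLevyMeasure₂ μ) : MemLp (fun z : E => z) 2 μ := by
  refine ⟨measurable_id.aestronglyMeasurable, ?_⟩
  rw [eLpNorm_lt_top_iff_lintegral_rpow_enorm_lt_top two_ne_zero ENNReal.ofNat_ne_top]
  simpa using h.secondMoment

theorem IsLevyMeasure₂.sigmaFinite (h : IsLevyMeasure₂ μ) : SigmaFinite μ := by
  obtain ⟨s, -, hs, hsσ⟩ := (h.memLp_id.finStronglyMeasurable_of_stronglyMeasurable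
    stronglyMeasurable_id two_ne_zero ENNReal.ofNat_ne_top).exists_set_sigmaFinite
  have hmem : ∀ᵐ z ∂μ, z ∈ s :=
    measure_mono_null (t := {0}) (fun z hz => by simpa using hs z hz) h.zero
  rwa [Measure.restrict_eq_self_of_ae_mem hmem] at hsσ

end LevyMeasure

section MovingAverage

theorem hasCharFunctional_of_isStochIntegral {Ω Z : Type*} [MeasurableSpace Ω] [MeasurableSpace Z]
    {p : ℕ} {P : Measure Ω} [IsProbabilityMeasure P] {N : Ω → Measure (ℝ × Z)}
    {ν : Measure (ℝ × Z)} {φ : ℝ → ℝ × Z → EuclideanSpace ℝ (Fin p)}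
    {Y : ℝ → Ω → EuclideanSpace ℝ (Fin p)} (hN : IsPoissonRandomMeasure P N ν)
    (hY : ∀ t, IsStochIntegral P N ν (φ t) (Y t)) :
    HasCharFunctional P Y φ (poissonCharFunctional ν) where
  aemeasurable t := (hY t).2.1.1.aemeasurable
  fddCharFun_eq := fddCharFun_of_isStochIntegral hN hY

variable {p : ℕ} {H : Matrix (Fin p) (Fin p) ℝ} {A : Matrix (Fin p) (Fin p) ℂ}
  {g : ℝ → ℝ → Matrix (Fin p) (Fin p) ℝ}

namespace IsTimeKernel

theorem zero_ae_eq (hg : IsTimeKernel H A g) : g 0 =ᵐ[volume] fun _ => 0 := by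
  have hentry : ∀ i j, (fun s => (g 0 s i j : ℂ)) =ᵐ[volume] fun _ => 0 := fun i j => by
    refine (hg 0 i j).ae_eq ?_
    simp only [harmKernel_zero, Matrix.zero_apply]
    exact IsL2Fourier.zero
  filter_upwards [eventually_all.2 fun i => eventually_all.2 (hentry i)] with s hs
  ext i j
  exact_mod_cast hs i j

theorem add_ae_eq (hg : IsTimeKernel H A g) (t h : ℝ) :
    g (t + h) =ᵐ[volume] fun s => g h s + g t (s - h) := by
  have hentry : ∀ i j, (fun s => (g (t + h) s i j : ℂ))
      =ᵐ[volume] fun s => (g h s i j : ℂ) + g t (s - h) i j := fun i j => by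
    refine (hg (t + h) i j).ae_eq ?_
    simp only [harmKernel_add, Matrix.add_apply, Matrix.smul_apply, smul_eq_mul]
    exact (hg h i j).add ((hg t i j).comp_sub h)
  filter_upwards [eventually_all.2 fun i => eventually_all.2 (hentry i)] with s hs
  ext i j
  exact_mod_cast hs i j

theorem mul_ae_eq (hg : IsTimeKernel H A g) {c : ℝ} (hc : 0 < c) (t : ℝ) :
    g (c * t) =ᵐ[volume] fun s => (√c)⁻¹ • (matPow c H * g t (c⁻¹ * s)) := by
  have hsqrt : ∀ y : ℂ, √c * y = (√c : ℂ)⁻¹ * (c * y) := fun y => by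
    rw [eq_inv_mul_iff_mul_eq₀ (Complex.ofReal_ne_zero.2 (Real.sqrt_ne_zero'.2 hc)),
      ← mul_assoc, ← Complex.ofReal_mul, Real.mul_self_sqrt hc.le]
  have hentry : ∀ i j, (fun s => (g (c * t) s i j : ℂ)) =ᵐ[volume]
      fun s => (√c : ℂ)⁻¹ * ∑ k, (matPow c H i k : ℂ) * g t (c⁻¹ * s) k j := fun i j => by
    refine (hg (c * t) i j).ae_eq ?_
    have hfourier := (IsL2Fourier.sum Finset.univ fun k =>
      ((hg t k j).comp_inv_mul hc).const_mul (matPow c H i k)).const_mul (√c : ℂ)⁻¹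
    convert hfourier using 2 with x
    rw [harmKernel_mul H A hc, Matrix.smul_apply, Matrix.mul_apply, smul_eq_mul, hsqrt,
      Finset.mul_sum]
    simp only [toComplex, Matrix.map_apply, mul_left_comm]
  filter_upwards [eventually_all.2 fun i => eventually_all.2 (hentry i)] with s hs
  ext i j
  rw [Matrix.smul_apply, Matrix.mul_apply, smul_eq_mul]
  exact_mod_cast hs i j

end IsTimeKernel

/-- The integrand `(s, z) ↦ g_t(s) z` of a moving average with time domain kernel `g`. -/
def maIntegrand (g : ℝ → ℝ → Matrix (Fin p) (Fin p) ℝ) (t : ℝ)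
    (x : ℝ × EuclideanSpace ℝ (Fin p)) : EuclideanSpace ℝ (Fin p) :=
  Matrix.toEuclideanLin (g t x.1) x.2

variable {μ : Measure (EuclideanSpace ℝ (Fin p))}

theorem IsTimeKernel.maIntegrand_zero_ae_eq (hg : IsTimeKernel H A g) :
    maIntegrand g 0 =ᵐ[(volume : Measure ℝ).prod μ] fun _ => 0 := by
  filter_upwards [Measure.quasiMeasurePreserving_fst.ae hg.zero_ae_eq] with x hx
  simp [maIntegrand, hx]

theorem IsTimeKernel.maIntegrand_add_sub_ae_eq (hg : IsTimeKernel H A g) (t h : ℝ) :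
    (fun x => maIntegrand g (t + h) x - maIntegrand g h x)
      =ᵐ[(volume : Measure ℝ).prod μ] fun x => maIntegrand g t (x.1 - h, x.2) := by
  filter_upwards [Measure.quasiMeasurePreserving_fst.ae (hg.add_ae_eq t h)] with x hx
  simp [maIntegrand, hx]

theorem IsTimeKernel.maIntegrand_mul_ae_eq (hg : IsTimeKernel H A g) {c : ℝ} (hc : 0 < c) (t : ℝ) :
    maIntegrand g (c * t) =ᵐ[(volume : Measure ℝ).prod μ]
      dilate c fun x => Matrix.toEuclideanLin (matPow c H) (maIntegrand g t x) := by
  filter_upwards [Measure.quasiMeasurePreserving_fst.ae (hg.mul_ae_eq hc t)] with x hx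
  simp [maIntegrand, dilate, hx, Matrix.toLpLin_apply]

variable [SFinite μ]

theorem integral_prod_comp_sub {Z : Type*} [MeasurableSpace Z] {μ : Measure Z} [SFinite μ]
    (f : ℝ × Z → ℝ) (h : ℝ) : ∫ x, f (x.1 - h, x.2) ∂(volume : Measure ℝ).prod μ
      = ∫ x, f x ∂(volume : Measure ℝ).prod μ :=
  ((measurePreserving_sub_right volume h).prod (.id μ)).integral_comp
    ((MeasurableEquiv.subRight h).measurableEmbedding.prodMap .id) f

theorem IsTimeKernel.hasFractionalCovariance (hg : IsTimeKernel H A g) :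
    HasFractionalCovariance ((volume : Measure ℝ).prod μ) (maIntegrand g) H where
  selfSimilar _ hc _ _ :=
    integral_linComb_sq_congr_dilate hc fun t => hg.maIntegrand_mul_ae_eq hc t
  stationary h J _ t θ := by
    have hzero : ∀ t, (fun x => maIntegrand g t x - maIntegrand g 0 x)
        =ᵐ[(volume : Measure ℝ).prod μ] maIntegrand g t := fun t => by
      filter_upwards [hg.maIntegrand_zero_ae_eq] with x hx
      rw [hx, sub_zero]
    calc ∫ x, linComb (fun t x => maIntegrand g (t + h) x - maIntegrand g h x) t θ x ^ 2
          ∂(volume : Measure ℝ).prod μ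
        = ∫ x, linComb (maIntegrand g) t θ (x.1 - h, x.2) ^ 2 ∂(volume : Measure ℝ).prod μ :=
          integral_congr_ae ((linComb_congr_ae
            (fun t => hg.maIntegrand_add_sub_ae_eq t h) t θ).fun_comp (· ^ 2))
      _ = ∫ x, linComb (maIntegrand g) t θ x ^ 2 ∂(volume : Measure ℝ).prod μ :=
          integral_prod_comp_sub (fun x => linComb (maIntegrand g) t θ x ^ 2) h
      _ = _ := integral_congr_ae ((linComb_congr_ae hzero t θ).symm.fun_comp (· ^ 2))

variable {Ω Ω' : Type*} [MeasurableSpace Ω] [MeasurableSpace Ω'] {P : Measure Ω} {Q : Measure Ω'}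
  [IsProbabilityMeasure P] [IsProbabilityMeasure Q] {X : ℝ → Ω → EuclideanSpace ℝ (Fin p)}
  {B : ℝ → Ω' → EuclideanSpace ℝ (Fin p)}

theorem IsTimeKernel.fddTendsto_matPow_neg (hg : IsTimeKernel H A g)
    (hgL : ∀ t, MemLp (maIntegrand g t) 2 ((volume : Measure ℝ).prod μ))
    (hX : HasCharFunctional P X (maIntegrand g)
      (poissonCharFunctional ((volume : Measure ℝ).prod μ)))
    (hB : HasCharFunctional Q B (maIntegrand g)
      (gaussianCharFunctional ((volume : Measure ℝ).prod μ))) :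
    FddTendsto P (fun c t ω => Matrix.toEuclideanLin (matPow c (-H)) (X (c * t) ω)) atTop Q B := by
  have hscaled : ∀ c : ℝ, HasCharFunctional P
      (fun t ω => Matrix.toEuclideanLin (matPow c (-H)) (X (c * t) ω))
      (fun t x => Matrix.toEuclideanLin (matPow c (-H)) (maIntegrand g (c * t) x))
      (poissonCharFunctional ((volume : Measure ℝ).prod μ)) := fun c =>
    (hX.comp_time (c * ·)).map_linear _
  refine fddTendsto_of_hasCharFunctional_dilate (r := id) (ψ := fun _ => maIntegrand g)
    (v := fun t x => ‖maIntegrand g t x‖) (fun c => (hscaled c).aemeasurable) ?_ tendsto_id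
    (fun _ t => (hgL t).1) (fun t => (hgL t).norm) (fun _ _ _ => le_rfl) (fun _ _ _ _ _ => rfl) hB
  filter_upwards [eventually_gt_atTop 0] with c hc
  refine (hscaled c).congr_ae fun t => ?_
  filter_upwards [hg.maIntegrand_mul_ae_eq (μ := μ) hc t] with x hx
  rw [hx]
  simp only [dilate, map_smul, toEuclideanLin_matPow_neg_matPow, id]

end MovingAverage

theorem ReEigIn.mono {p : ℕ} {H : Matrix (Fin p) (Fin p) ℝ} {S T : Set ℝ} (h : ReEigIn H S)
    (hST : S ⊆ T) : ReEigIn H T := fun z hz => hST (h z hz)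

theorem IsMaofLm.exists_isOfBm_fddTendsto {Ω : Type u} [MeasurableSpace Ω] {p : ℕ} {P : Measure Ω}
    [IsProbabilityMeasure P] {X : ℝ → Ω → EuclideanSpace ℝ (Fin p)}
    {H : Matrix (Fin p) (Fin p) ℝ} {A : Matrix (Fin p) (Fin p) ℂ}
    {μ : Measure (EuclideanSpace ℝ (Fin p))} (hX : IsMaofLm.{u, v} P X H A μ) :
    ∃ (Ω' : Type) (_ : MeasurableSpace Ω') (Q : Measure Ω') (_ : IsProbabilityMeasure Q)
      (B : ℝ → Ω' → EuclideanSpace ℝ (Fin p)), IsOfBm Q B H ∧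
        FddTendsto P (fun c t ω => Matrix.toEuclideanLin (matPow c (-H)) (X (c * t) ω))
          atTop Q B := by
  have _ := hX.levy.sigmaFinite
  obtain ⟨_, _, P', N, g, Y, _, hN, hg, hY, hXY⟩ := hX.representation
  have hXφ := (hasCharFunctional_of_isStochIntegral (φ := maIntegrand g) hN hY).of_fddEq hXY
  have hgL : ∀ t, MemLp (maIntegrand g t) 2 ((volume : Measure ℝ).prod μ) := fun t => (hY t).1
  obtain ⟨Ω', _, Q, _, B, hB, hBφ⟩ := exists_isOfBm_hasCharFunctional hXφ hX.proper hgL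
    hg.hasFractionalCovariance (hX.hurst.mono Set.Ioo_subset_Ioc_self)
  exact ⟨Ω', _, Q, ‹_›, B, hB, hg.fddTendsto_matPow_neg hgL hXφ hBφ⟩

section PhaseInvariance

variable {p : ℕ} {μ : Measure (EuclideanSpace ℂ (Fin p))}

/-- The second moments of `Re z` and `Im z` under `μ` coincide. This is what makes the covariance of
a real harmonizable process invariant under a change of phase of its kernel. -/
def HasEqualReImSecondMoments (μ : Measure (EuclideanSpace ℂ (Fin p))) : Prop :=
  ∀ k l, ∫ z, (z k).re * (z l).re ∂μ = ∫ z, (z k).im * (z l).im ∂μ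

theorem IsLevyMeasure₂.memLp_apply (hμ : IsLevyMeasure₂ μ) (k : Fin p) :
    MemLp (fun z : EuclideanSpace ℂ (Fin p) => z k) 2 μ :=
  (EuclideanSpace.proj (𝕜 := ℂ) k : EuclideanSpace ℂ (Fin p) →L[ℂ] ℂ).comp_memLp' hμ.memLp_id

theorem IsLevyMeasure₂.memLp_re_dotProduct (hμ : IsLevyMeasure₂ μ) (w : Fin p → ℂ) :
    MemLp (fun z => (w ⬝ᵥ z.ofLp).re) 2 μ :=
  (memLp_finsetSum _ fun k _ => (hμ.memLp_apply k).const_mul (w k)).re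

theorem re_dotProduct_sq_add_re_star_dotProduct_sq (w z : Fin p → ℂ) :
    (w ⬝ᵥ z).re ^ 2 + (star w ⬝ᵥ z).re ^ 2
      = 2 * ∑ k, ∑ l, ((w k).re * (w l).re * ((z k).re * (z l).re)
        + (w k).im * (w l).im * ((z k).im * (z l).im)) := by
  have hparallelogram : (w ⬝ᵥ z).re ^ 2 + (star w ⬝ᵥ z).re ^ 2
      = 2 * ((∑ k, (w k).re * (z k).re) ^ 2 + (∑ k, (w k).im * (z k).im) ^ 2) := by
    simp only [dotProduct, Complex.re_sum, Complex.mul_re, Pi.star_apply, RCLike.star_def,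
      Complex.conj_re, Complex.conj_im, neg_mul, sub_neg_eq_add, Finset.sum_add_distrib,
      Finset.sum_sub_distrib]
    ring
  rw [hparallelogram]
  simp only [pow_two, Finset.sum_mul_sum, ← Finset.sum_add_distrib, mul_mul_mul_comm]

theorem integral_re_dotProduct_sq_add (hμ : IsLevyMeasure₂ μ)
    (hμ' : HasEqualReImSecondMoments μ) (w : Fin p → ℂ) :
    ∫ z, ((w ⬝ᵥ z.ofLp).re ^ 2 + (star w ⬝ᵥ z.ofLp).re ^ 2) ∂μ
      = 2 * ∑ k, ∑ l, (w k * star (w l)).re * ∫ z, (z k).re * (z l).re ∂μ := by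
  have hre : ∀ k l (a : ℝ), Integrable (fun z => a * ((z k).re * (z l).re)) μ := fun k l a =>
    ((hμ.memLp_apply k).re.integrable_mul (hμ.memLp_apply l).re).const_mul a
  have him : ∀ k l (a : ℝ), Integrable (fun z => a * ((z k).im * (z l).im)) μ := fun k l a =>
    ((hμ.memLp_apply k).im.integrable_mul (hμ.memLp_apply l).im).const_mul a
  have hadd : ∀ k l, Integrable (fun z => (w k).re * (w l).re * ((z k).re * (z l).re)
      + (w k).im * (w l).im * ((z k).im * (z l).im)) μ := fun k l => (hre k l _).add (him k l _)
  simp only [re_dotProduct_sq_add_re_star_dotProduct_sq]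
  rw [integral_const_mul,
    integral_finsetSum _ fun k _ => integrable_finsetSum _ fun l _ => hadd k l]
  congr 1
  refine Finset.sum_congr rfl fun k _ => ?_
  rw [integral_finsetSum _ fun l _ => hadd k l]
  refine Finset.sum_congr rfl fun l _ => ?_
  rw [integral_add (hre k l _) (him k l _), integral_const_mul, integral_const_mul, ← hμ' k l,
    ← add_mul]
  simp

theorem lintegral_re_dotProduct_sq_add_smul (hμ : IsLevyMeasure₂ μ)
    (hμ' : HasEqualReImSecondMoments μ) {ζ : ℂ} (hζ : ‖ζ‖ = 1) (w : Fin p → ℂ) :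
    (∫⁻ z, ‖((ζ • w) ⬝ᵥ z.ofLp).re‖ₑ ^ 2 ∂μ) + ∫⁻ z, ‖(star (ζ • w) ⬝ᵥ z.ofLp).re‖ₑ ^ 2 ∂μ
      = (∫⁻ z, ‖(w ⬝ᵥ z.ofLp).re‖ₑ ^ 2 ∂μ) + ∫⁻ z, ‖(star w ⬝ᵥ z.ofLp).re‖ₑ ^ 2 ∂μ := by
  have henergy : ∀ w : Fin p → ℂ, (∫⁻ z, ‖(w ⬝ᵥ z.ofLp).re‖ₑ ^ 2 ∂μ)
      + ∫⁻ z, ‖(star w ⬝ᵥ z.ofLp).re‖ₑ ^ 2 ∂μ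
        = ENNReal.ofReal (∫ z, ((w ⬝ᵥ z.ofLp).re ^ 2 + (star w ⬝ᵥ z.ofLp).re ^ 2) ∂μ) := fun w => by
    have hsq := fun w => (hμ.memLp_re_dotProduct w).integrable_sq
    rw [integral_add (hsq w) (hsq _), ENNReal.ofReal_add (integral_nonneg fun _ => sq_nonneg _)
      (integral_nonneg fun _ => sq_nonneg _),
      ofReal_integral_eq_lintegral_ofReal (hsq w) (ae_of_all _ fun _ => sq_nonneg _),
      ofReal_integral_eq_lintegral_ofReal (hsq _) (ae_of_all _ fun _ => sq_nonneg _)]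
    simp only [← Real.enorm_of_nonneg (sq_nonneg _), enorm_pow]
  have hphase : ∀ a b : ℂ, ζ * a * star (ζ * b) = a * star b := fun a b => by
    have hζζ : ζ * star ζ = 1 := by simp [Complex.mul_conj', hζ]
    rw [star_mul']
    linear_combination a * star b * hζζ
  simp only [henergy, integral_re_dotProduct_sq_add hμ hμ', Pi.smul_apply, smul_eq_mul, hphase]

theorem measurable_re_dotProduct {w : ℝ → Fin p → ℂ} (hw : ∀ k, Measurable fun x => w x k) :
    Measurable fun x : ℝ × EuclideanSpace ℂ (Fin p) => (w x.1 ⬝ᵥ x.2.ofLp).re := by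
  unfold dotProduct
  fun_prop

variable [SFinite μ]

theorem lintegral_prod_re_dotProduct_sq {w : ℝ → Fin p → ℂ}
    (hw : ∀ k, Measurable fun x => w x k)
    (hwneg : ∀ x, w (-x) = star (w x) ∨ w (-x) = -star (w x)) :
    2 * ∫⁻ x, ‖(w x.1 ⬝ᵥ x.2.ofLp).re‖ₑ ^ 2 ∂(volume : Measure ℝ).prod μ
      = ∫⁻ x, ((∫⁻ z, ‖(w x ⬝ᵥ z.ofLp).re‖ₑ ^ 2 ∂μ)
          + ∫⁻ z, ‖(star (w x) ⬝ᵥ z.ofLp).re‖ₑ ^ 2 ∂μ) := by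
  have hmeas : Measurable fun x : ℝ × EuclideanSpace ℂ (Fin p) =>
      ‖(w x.1 ⬝ᵥ x.2.ofLp).re‖ₑ ^ 2 := (measurable_re_dotProduct hw).enorm.pow_const 2
  have hreflect : ∫⁻ x, ∫⁻ z, ‖(w x ⬝ᵥ z.ofLp).re‖ₑ ^ 2 ∂μ
      = ∫⁻ x, ∫⁻ z, ‖(star (w x) ⬝ᵥ z.ofLp).re‖ₑ ^ 2 ∂μ := by
    rw [← lintegral_neg_eq_self]
    refine lintegral_congr fun x => ?_
    rcases hwneg x with h | h <;> simp [h]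
  rw [lintegral_add_left hmeas.lintegral_prod_right', ← hreflect, ← two_mul,
    lintegral_prod _ hmeas.aemeasurable]

theorem lintegral_prod_re_smul_dotProduct_sq (hμ : IsLevyMeasure₂ μ)
    (hμ' : HasEqualReImSecondMoments μ) {ζ : ℝ → ℂ} (hζ : Measurable ζ)
    (hζ_norm : ∀ x, ‖ζ x‖ = 1)
    (hζneg : ∀ x, ζ (-x) = star (ζ x) ∨ ζ (-x) = -star (ζ x)) {w : ℝ → Fin p → ℂ}
    (hw : ∀ k, Measurable fun x => w x k) (hwneg : ∀ x, w (-x) = star (w x)) :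
    ∫⁻ x, ‖((ζ x.1 • w x.1) ⬝ᵥ x.2.ofLp).re‖ₑ ^ 2 ∂(volume : Measure ℝ).prod μ
      = ∫⁻ x, ‖(w x.1 ⬝ᵥ x.2.ofLp).re‖ₑ ^ 2 ∂(volume : Measure ℝ).prod μ := by
  have hζw : ∀ k, Measurable fun x => (ζ x • w x) k := fun k => hζ.mul (hw k)
  have hζwneg : ∀ x, ζ (-x) • w (-x) = star (ζ x • w x)
      ∨ ζ (-x) • w (-x) = -star (ζ x • w x) := fun x => by
    rw [hwneg, star_smul, ← neg_smul]
    exact (hζneg x).imp (fun h => by rw [h]) fun h => by rw [h]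
  rw [← ENNReal.mul_right_inj two_ne_zero ENNReal.ofNat_ne_top,
    lintegral_prod_re_dotProduct_sq hζw hζwneg,
    lintegral_prod_re_dotProduct_sq hw fun x => .inl (hwneg x)]
  exact lintegral_congr fun x => lintegral_re_dotProduct_sq_add_smul hμ hμ' (hζ_norm x) (w x)

theorem integral_prod_re_smul_dotProduct_sq (hμ : IsLevyMeasure₂ μ)
    (hμ' : HasEqualReImSecondMoments μ) {ζ : ℝ → ℂ} (hζ : Measurable ζ)
    (hζ_norm : ∀ x, ‖ζ x‖ = 1)
    (hζneg : ∀ x, ζ (-x) = star (ζ x) ∨ ζ (-x) = -star (ζ x)) {w : ℝ → Fin p → ℂ}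
    (hw : ∀ k, Measurable fun x => w x k) (hwneg : ∀ x, w (-x) = star (w x)) :
    ∫ x, ((ζ x.1 • w x.1) ⬝ᵥ x.2.ofLp).re ^ 2 ∂(volume : Measure ℝ).prod μ
      = ∫ x, (w x.1 ⬝ᵥ x.2.ofLp).re ^ 2 ∂(volume : Measure ℝ).prod μ := by
  have hlintegral : ∀ {w : ℝ → Fin p → ℂ}, (∀ k, Measurable fun x => w x k) →
      ∫ x, (w x.1 ⬝ᵥ x.2.ofLp).re ^ 2 ∂(volume : Measure ℝ).prod μ
        = (∫⁻ x, ‖(w x.1 ⬝ᵥ x.2.ofLp).re‖ₑ ^ 2 ∂(volume : Measure ℝ).prod μ).toReal := fun hw => by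
    rw [integral_eq_lintegral_of_nonneg_ae (ae_of_all _ fun _ => sq_nonneg _)
      ((measurable_re_dotProduct hw).pow_const 2).aestronglyMeasurable]
    simp only [← Real.enorm_of_nonneg (sq_nonneg _), enorm_pow]
  rw [hlintegral hw, ← lintegral_prod_re_smul_dotProduct_sq hμ hμ' hζ hζ_norm hζneg hw hwneg]
  exact hlintegral (w := fun x => ζ x • w x) fun k => hζ.mul (hw k)

theorem memLp_dotProduct (hμ : IsLevyMeasure₂ μ) (hμ' : HasEqualReImSecondMoments μ)
    {w : ℝ → Fin p → ℂ} (hw : ∀ k, Measurable fun x => w x k) (hwneg : ∀ x, w (-x) = star (w x))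
    (hre : MemLp (fun x : ℝ × EuclideanSpace ℂ (Fin p) => (w x.1 ⬝ᵥ x.2.ofLp).re) 2
      ((volume : Measure ℝ).prod μ)) :
    MemLp (fun x : ℝ × EuclideanSpace ℂ (Fin p) => w x.1 ⬝ᵥ x.2.ofLp) 2
      ((volume : Measure ℝ).prod μ) := by
  have hrotate : MemLp (fun x : ℝ × EuclideanSpace ℂ (Fin p) =>
      ((-Complex.I • w x.1) ⬝ᵥ x.2.ofLp).re) 2 ((volume : Measure ℝ).prod μ) := by
    refine ⟨(measurable_re_dotProduct (w := fun x => -Complex.I • w x)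
      fun k => (hw k).const_mul _).aestronglyMeasurable, ?_⟩
    have hfinite := hre.eLpNorm_lt_top
    rw [eLpNorm_lt_top_iff_lintegral_rpow_enorm_lt_top two_ne_zero ENNReal.ofNat_ne_top]
      at hfinite ⊢
    simp only [ENNReal.toReal_ofNat, ENNReal.rpow_ofNat] at hfinite ⊢
    rwa [lintegral_prod_re_smul_dotProduct_sq hμ hμ' (ζ := fun _ => -Complex.I) measurable_const
      (by simp) (by simp) hw hwneg]
  refine memLp_re_im_iff.1 ⟨hre, ?_⟩
  simpa [smul_dotProduct] using hrotate

end PhaseInvariance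

section Harmonizable

variable {p : ℕ}

/-- The integrand `(x, z) ↦ 2 Re (G(x) z)` of a real harmonizable process with Fourier domain
kernel `G`. -/
def rhIntegrand (G : ℝ → Matrix (Fin p) (Fin p) ℂ) (x : ℝ × EuclideanSpace ℂ (Fin p)) :
    EuclideanSpace ℝ (Fin p) :=
  WithLp.toLp 2 fun i => 2 * (Matrix.toEuclideanLin (G x.1) x.2 i).re

theorem rhIntegrand_sub (G G' : ℝ → Matrix (Fin p) (Fin p) ℂ)
    (x : ℝ × EuclideanSpace ℂ (Fin p)) :
    rhIntegrand G x - rhIntegrand G' x = rhIntegrand (fun y => G y - G' y) x := by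
  ext i
  simp [rhIntegrand, mul_sub]

theorem rhIntegrand_ofReal_smul (r : ℝ) (G : ℝ → Matrix (Fin p) (Fin p) ℂ)
    (x : ℝ × EuclideanSpace ℂ (Fin p)) :
    rhIntegrand (fun y => (r : ℂ) • G y) x = r • rhIntegrand G x := by
  ext i
  simp only [rhIntegrand, map_smul, LinearMap.smul_apply, PiLp.smul_apply, smul_eq_mul,
    Complex.re_ofReal_mul, mul_left_comm]

theorem rhIntegrand_toComplex_mul (M : Matrix (Fin p) (Fin p) ℝ)
    (G : ℝ → Matrix (Fin p) (Fin p) ℂ) (x : ℝ × EuclideanSpace ℂ (Fin p)) :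
    rhIntegrand (fun y => toComplex M * G y) x = Matrix.toEuclideanLin M (rhIntegrand G x) := by
  ext i
  simp only [rhIntegrand, Matrix.toLpLin_apply, ← Matrix.mulVec_mulVec]
  rw [Matrix.mulVec, Matrix.mulVec]
  simp only [dotProduct, toComplex, Matrix.map_apply, Complex.re_sum, Complex.re_ofReal_mul,
    Finset.mul_sum, mul_left_comm]

theorem norm_rhIntegrand_le (G : ℝ → Matrix (Fin p) (Fin p) ℂ)
    (x : ℝ × EuclideanSpace ℂ (Fin p)) :
    ‖rhIntegrand G x‖ ≤ 2 * ‖Matrix.toEuclideanLin (G x.1) x.2‖ := by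
  rw [← Real.norm_of_nonneg zero_le_two, ← norm_smul, EuclideanSpace.norm_eq,
    EuclideanSpace.norm_eq]
  gcongr with i
  simpa [rhIntegrand, abs_mul] using Complex.abs_re_le_norm (Matrix.toEuclideanLin (G x.1) x.2 i)

theorem linComb_rhIntegrand {J : Type*} [Fintype J] (G : ℝ → ℝ → Matrix (Fin p) (Fin p) ℂ)
    (t : J → ℝ) (θ : J → EuclideanSpace ℝ (Fin p)) (x : ℝ × EuclideanSpace ℂ (Fin p)) :
    linComb (fun t => rhIntegrand (G t)) t θ x
      = 2 * ((∑ j, Matrix.vecMul (fun i => (θ j i : ℂ)) (G (t j) x.1)) ⬝ᵥ x.2.ofLp).re := by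
  simp only [linComb, rhIntegrand, sum_dotProduct, ← Matrix.dotProduct_mulVec]
  simp only [Matrix.toLpLin_apply, dotProduct, PiLp.inner_apply, Complex.re_sum, Finset.mul_sum,
    Complex.re_ofReal_mul]
  refine Finset.sum_congr rfl fun j _ => Finset.sum_congr rfl fun i _ => ?_
  simp only [RCLike.inner_apply, conj_trivial]
  ring

variable {H : Matrix (Fin p) (Fin p) ℝ} {A : Matrix (Fin p) (Fin p) ℂ}
  {μ : Measure (EuclideanSpace ℂ (Fin p))}

theorem measurable_rhIntegrand {G : ℝ → Matrix (Fin p) (Fin p) ℂ}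
    (hG : ∀ i k, Measurable fun x => G x i k) : Measurable (rhIntegrand G) :=
  (WithLp.measurable_toLp 2 _).comp <| measurable_pi_lambda _ fun i =>
    (measurable_re_dotProduct (hG i)).const_mul 2

theorem rhIntegrand_harmKernel_zero (x : ℝ × EuclideanSpace ℂ (Fin p)) :
    rhIntegrand (harmKernel H A 0) x = 0 := by
  ext i
  simp [rhIntegrand, harmKernel_zero]

theorem rhIntegrand_harmKernel_add_sub (t h : ℝ) (x : ℝ × EuclideanSpace ℂ (Fin p)) :
    rhIntegrand (harmKernel H A (t + h)) x - rhIntegrand (harmKernel H A h) x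
      = rhIntegrand (incrementKernel H A h t) x := by
  rw [rhIntegrand_sub]
  simp only [harmKernel_add, add_sub_cancel_left]
  rfl

theorem rhIntegrand_incrementKernel_mul {c : ℝ} (hc : 0 < c) (h t : ℝ) :
    rhIntegrand (incrementKernel H A (c * h) (c * t))
      = dilate c⁻¹ fun x => Matrix.toEuclideanLin (matPow c H)
        (rhIntegrand (incrementKernel H A h t) x) := by
  funext x
  simp only [dilate, inv_inv, Real.sqrt_inv, ← rhIntegrand_toComplex_mul,
    ← rhIntegrand_ofReal_smul]
  simp only [rhIntegrand, incrementKernel_mul H A hc]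

theorem norm_rhIntegrand_incrementKernel_le (h t : ℝ) (x : ℝ × EuclideanSpace ℂ (Fin p)) :
    ‖rhIntegrand (incrementKernel H A h t) x‖
      ≤ 2 * ‖Matrix.toEuclideanLin (harmKernel H A t x.1) x.2‖ := by
  refine (norm_rhIntegrand_le _ x).trans_eq ?_
  rw [incrementKernel, map_smul, LinearMap.smul_apply, norm_smul, norm_exp_I_mul_mul, one_mul]

variable [SFinite μ]

theorem integral_linComb_rhIntegrand_incrementKernel_sq (hμ : IsLevyMeasure₂ μ)
    (hμ' : HasEqualReImSecondMoments μ) (h : ℝ) {J : Type*} [Fintype J] (t : J → ℝ)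
    (θ : J → EuclideanSpace ℝ (Fin p)) :
    ∫ x, linComb (fun t => rhIntegrand (incrementKernel H A h t)) t θ x ^ 2
        ∂(volume : Measure ℝ).prod μ
      = ∫ x, linComb (fun t => rhIntegrand (harmKernel H A t)) t θ x ^ 2
        ∂(volume : Measure ℝ).prod μ := by
  have hw : ∀ k, Measurable fun x =>
      (∑ j, Matrix.vecMul (fun i => (θ j i : ℂ)) (harmKernel H A (t j) x)) k := fun k => by
    simp only [Finset.sum_apply, Matrix.vecMul, dotProduct]
    exact Finset.measurable_sum _ fun j _ => Finset.measurable_sum _ fun i _ =>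
      (measurable_harmKernel H A (t j) i k).const_mul _
  have hwneg : ∀ x, ∑ j, Matrix.vecMul (fun i => (θ j i : ℂ)) (harmKernel H A (t j) (-x))
      = star (∑ j, Matrix.vecMul (fun i => (θ j i : ℂ)) (harmKernel H A (t j) x)) := fun x => by
    ext k
    simp [harmKernel_neg, Matrix.vecMul, dotProduct]
  have hphase_neg : ∀ x : ℝ, Complex.exp (Complex.I * h * (-x : ℝ))
      = star (Complex.exp (Complex.I * h * x)) := fun x => by
    simp [← Complex.exp_conj]
  simp only [linComb_rhIntegrand, incrementKernel, Matrix.vecMul_smul, ← Finset.smul_sum, mul_pow,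
    integral_const_mul]
  rw [integral_prod_re_smul_dotProduct_sq hμ hμ' (by fun_prop) (norm_exp_I_mul_mul h)
    (fun x => .inl (hphase_neg x)) hw hwneg]

theorem memLp_toEuclideanLin_harmKernel (hμ : IsLevyMeasure₂ μ)
    (hμ' : HasEqualReImSecondMoments μ) {t : ℝ}
    (hφ : MemLp (rhIntegrand (harmKernel H A t)) 2 ((volume : Measure ℝ).prod μ)) :
    MemLp (fun x : ℝ × EuclideanSpace ℂ (Fin p) =>
      Matrix.toEuclideanLin (harmKernel H A t x.1) x.2) 2 ((volume : Measure ℝ).prod μ) := by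
  have hrow : ∀ i, MemLp (fun x : ℝ × EuclideanSpace ℂ (Fin p) =>
      harmKernel H A t x.1 i ⬝ᵥ x.2.ofLp) 2 ((volume : Measure ℝ).prod μ) := fun i => by
    refine memLp_dotProduct hμ hμ' (w := fun x => harmKernel H A t x i)
      (measurable_harmKernel H A t i) (fun x => ?_) ?_
    · ext k
      simp [harmKernel_neg]
    · simpa [rhIntegrand, Matrix.mulVec] using (hφ.eval_piLp i).const_mul 2⁻¹
  exact MemLp.of_eval_piLp hrow

theorem hasFractionalCovariance_rhIntegrand_harmKernel (hμ : IsLevyMeasure₂ μ)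
    (hμ' : HasEqualReImSecondMoments μ) :
    HasFractionalCovariance ((volume : Measure ℝ).prod μ)
      (fun t => rhIntegrand (harmKernel H A t)) H where
  selfSimilar c hc _ _ := integral_linComb_sq_congr_dilate (inv_pos.2 hc) fun t => by
    simpa only [mul_zero, incrementKernel_zero] using
      (rhIntegrand_incrementKernel_mul hc 0 t).eventuallyEq
  stationary h J _ t θ := by
    simp only [rhIntegrand_harmKernel_add_sub, rhIntegrand_harmKernel_zero, sub_zero]
    exact integral_linComb_rhIntegrand_incrementKernel_sq hμ hμ' h t θ

variable {Ω Ω' : Type*} [MeasurableSpace Ω] [MeasurableSpace Ω'] {P : Measure Ω} {Q : Measure Ω'}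
  [IsProbabilityMeasure P] [IsProbabilityMeasure Q] {X : ℝ → Ω → EuclideanSpace ℝ (Fin p)}
  {B : ℝ → Ω' → EuclideanSpace ℝ (Fin p)}

theorem fddTendsto_matPow_neg_increment (hμ : IsLevyMeasure₂ μ)
    (hμ' : HasEqualReImSecondMoments μ)
    (hφL : ∀ t, MemLp (rhIntegrand (harmKernel H A t)) 2 ((volume : Measure ℝ).prod μ))
    (hX : HasCharFunctional P X (fun t => rhIntegrand (harmKernel H A t))
      (poissonCharFunctional ((volume : Measure ℝ).prod μ)))
    (hB : HasCharFunctional Q B (fun t => rhIntegrand (harmKernel H A t))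
      (gaussianCharFunctional ((volume : Measure ℝ).prod μ))) (s : ℝ) :
    FddTendsto P (fun ε t ω => Matrix.toEuclideanLin (matPow ε (-H)) (X (s + ε * t) ω - X s ω))
      (𝓝[>] 0) Q B := by
  have hscaled : ∀ ε : ℝ, HasCharFunctional P
      (fun t ω => Matrix.toEuclideanLin (matPow ε (-H)) (X (s + ε * t) ω - X s ω))
      (fun t x => Matrix.toEuclideanLin (matPow ε (-H))
        (rhIntegrand (harmKernel H A (s + ε * t)) x - rhIntegrand (harmKernel H A s) x))
      (poissonCharFunctional ((volume : Measure ℝ).prod μ)) := fun ε =>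
    (hX.sub (s + ε * ·) fun _ => s).map_linear _
  refine fddTendsto_of_hasCharFunctional_dilate (r := fun ε => ε⁻¹)
    (ψ := fun ε t => rhIntegrand (incrementKernel H A (s / ε) t))
    (v := fun t x => 2 * ‖Matrix.toEuclideanLin (harmKernel H A t x.1) x.2‖)
    (fun ε => (hscaled ε).aemeasurable) ?_ tendsto_inv_nhdsGT_zero
    (fun ε t => (measurable_rhIntegrand (measurable_incrementKernel H A _ t)).aestronglyMeasurable)
    (fun t => (memLp_toEuclideanLin_harmKernel hμ hμ' (hφL t)).norm.const_mul 2)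
    (fun ε t x => norm_rhIntegrand_incrementKernel_le _ t x)
    (fun ε _ _ => integral_linComb_rhIntegrand_incrementKernel_sq hμ hμ' (s / ε)) hB
  filter_upwards [self_mem_nhdsWithin] with ε hε
  refine (hscaled ε).congr_ae fun t => .of_eq <| funext fun x => ?_
  have hscaling := rhIntegrand_incrementKernel_mul (H := H) (A := A) hε (s / ε) t
  rw [mul_div_cancel₀ s (ne_of_gt hε)] at hscaling
  rw [add_comm s, rhIntegrand_harmKernel_add_sub, hscaling]
  simp only [dilate, map_smul, toEuclideanLin_matPow_neg_matPow]

end Harmonizable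

theorem IsRhofLm.exists_isOfBm_fddTendsto {Ω : Type u} [MeasurableSpace Ω] {p : ℕ} {P : Measure Ω}
    [IsProbabilityMeasure P] {X : ℝ → Ω → EuclideanSpace ℝ (Fin p)}
    {H : Matrix (Fin p) (Fin p) ℝ} {A : Matrix (Fin p) (Fin p) ℂ}
    {μ : Measure (EuclideanSpace ℂ (Fin p))} (hX : IsRhofLm.{u, v} P X H A μ)
    (hμ : HasEqualReImSecondMoments μ) :
    ∃ (Ω' : Type) (_ : MeasurableSpace Ω') (Q : Measure Ω') (_ : IsProbabilityMeasure Q)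
      (B : ℝ → Ω' → EuclideanSpace ℝ (Fin p)), IsOfBm Q B H ∧
        ∀ s : ℝ, FddTendsto P
          (fun ε t ω => Matrix.toEuclideanLin (matPow ε (-H)) (X (s + ε * t) ω - X s ω))
          (𝓝[>] 0) Q B := by
  have _ := hX.levy.sigmaFinite
  obtain ⟨_, _, P', N, Y, _, hN, hY, hXY⟩ := hX.representation
  have hXφ := (hasCharFunctional_of_isStochIntegral
    (φ := fun t => rhIntegrand (harmKernel H A t)) hN hY).of_fddEq hXY
  have hφL : ∀ t, MemLp (rhIntegrand (harmKernel H A t)) 2 ((volume : Measure ℝ).prod μ) :=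
    fun t => (hY t).1
  obtain ⟨Ω', _, Q, _, B, hB, hBφ⟩ := exists_isOfBm_hasCharFunctional hXφ hX.proper hφL
    (hasFractionalCovariance_rhIntegrand_harmKernel hX.levy hμ)
    (hX.hurst.mono Set.Ioo_subset_Ioc_self)
  exact ⟨Ω', _, Q, ‹_›, B, hB, fddTendsto_matPow_neg_increment hX.levy hμ hφL hXφ hBφ⟩

theorem HasComplexIdentitySecondMoment.hasEqualReImSecondMoments {p : ℕ}
    {μ : Measure (EuclideanSpace ℂ (Fin p))} (h : HasComplexIdentitySecondMoment μ) :
    HasEqualReImSecondMoments μ := fun k l =>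
  mul_left_cancel₀ four_ne_zero ((h.1 k l).trans (h.2 k l).symm)

end OfLm

end

theorem propositionp_general {p : ℕ} (H : Matrix (Fin p) (Fin p) ℝ) :
    (∀ (Ω : Type u) [MeasurableSpace Ω] (P : Measure Ω) [IsProbabilityMeasure P]
      (X : ℝ → Ω → EuclideanSpace ℝ (Fin p)) (A : Matrix (Fin p) (Fin p) ℂ)
      (μ : Measure (EuclideanSpace ℝ (Fin p))),
      OfLm.IsMaofLm.{u, v} P X H A μ →
      ∃ (Ω' : Type) (_ : MeasurableSpace Ω') (P' : Measure Ω') (_ : IsProbabilityMeasure P')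
        (B : ℝ → Ω' → EuclideanSpace ℝ (Fin p)),
        OfLm.IsOfBm P' B H ∧
        OfLm.FddTendsto P
          (fun c t ω => Matrix.toEuclideanLin (OfLm.matPow c (-H)) (X (c * t) ω))
          atTop P' B) ∧
    (∀ (Ω : Type u) [MeasurableSpace Ω] (P : Measure Ω) [IsProbabilityMeasure P]
      (X : ℝ → Ω → EuclideanSpace ℝ (Fin p)) (A : Matrix (Fin p) (Fin p) ℂ)
      (μ : Measure (EuclideanSpace ℂ (Fin p))),
      OfLm.IsRhofLm.{u, v} P X H A μ → OfLm.HasEqualReImSecondMoments μ →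
      ∃ (Ω' : Type) (_ : MeasurableSpace Ω') (P' : Measure Ω') (_ : IsProbabilityMeasure P')
        (B : ℝ → Ω' → EuclideanSpace ℝ (Fin p)),
        OfLm.IsOfBm P' B H ∧
        ∀ s : ℝ, OfLm.FddTendsto P
          (fun ε t ω => Matrix.toEuclideanLin (OfLm.matPow ε (-H)) (X (s + ε * t) ω - X s ω))
          (𝓝[>] 0) P' B) :=
  ⟨fun _ _ _ _ _ _ _ hX => hX.exists_isOfBm_fddTendsto,
    fun _ _ _ _ _ _ _ hX hμ => hX.exists_isOfBm_fddTendsto hμ⟩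

theorem propositionp {p : ℕ} (H : Matrix (Fin p) (Fin p) ℝ)
    (hH : OfLm.ReEigIn H (Set.Ioo 0 1)) :
    (∀ (Ω : Type u) [MeasurableSpace Ω] (P : Measure Ω) [IsProbabilityMeasure P]
      (X : ℝ → Ω → EuclideanSpace ℝ (Fin p)) (A : Matrix (Fin p) (Fin p) ℂ)
      (μ : Measure (EuclideanSpace ℝ (Fin p))),
      OfLm.IsMaofLm.{u, v} P X H A μ → OfLm.HasIdentitySecondMoment μ →
      ∃ (Ω' : Type) (_ : MeasurableSpace Ω') (P' : Measure Ω') (_ : IsProbabilityMeasure P')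
        (B : ℝ → Ω' → EuclideanSpace ℝ (Fin p)),
        OfLm.IsOfBm P' B H ∧
        OfLm.FddTendsto P
          (fun c t ω => Matrix.toEuclideanLin (OfLm.matPow c (-H)) (X (c * t) ω))
          atTop P' B) ∧
    (∀ (Ω : Type u) [MeasurableSpace Ω] (P : Measure Ω) [IsProbabilityMeasure P]
      (X : ℝ → Ω → EuclideanSpace ℝ (Fin p)) (A : Matrix (Fin p) (Fin p) ℂ)
      (μ : Measure (EuclideanSpace ℂ (Fin p))),
      OfLm.IsRhofLm.{u, v} P X H A μ → OfLm.HasComplexIdentitySecondMoment μ →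
      ∃ (Ω' : Type) (_ : MeasurableSpace Ω') (P' : Measure Ω') (_ : IsProbabilityMeasure P')
        (B : ℝ → Ω' → EuclideanSpace ℝ (Fin p)),
        OfLm.IsOfBm P' B H ∧
        ∀ s : ℝ, OfLm.FddTendsto P
          (fun ε t ω => Matrix.toEuclideanLin (OfLm.matPow ε (-H)) (X (s + ε * t) ω - X s ω))
          (𝓝[>] 0) P' B) :=
  ⟨fun Ω _ P _ X A μ hX _ => (propositionp_general H).1 Ω P X A μ hX,
    fun Ω _ P _ X A μ hX hμ =>
      (propositionp_general H).2 Ω P X A μ hX hμ.hasEqualReImSecondMoments⟩
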